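/- Consider the $M/M/c$ queue ($c\ge 1$) with two customer classes, class-$n$ Poisson arrivals of rate $\lambda_n>0$ and exponential service requirements of rate $\mu_n>0$ ($n=1,2$), in which class 2 has preemptive-resume priority over class 1. Let $X=(X_1,X_2)$, where $X_n(t)$ is the number of class-$n$ customers at time $t$; that is, $X$ is the continuous-time Markov chain on $\mathbb N_0^2$ whose non-zero off-diagonal transition rates are $$q((i,j),(i+1,j))=\lambda_1,\quad q((i,j),(i,j+1))=\lambda_2\qquad(i,j\ge 0),$$ $$q((i,j),(i-1,j))=\max(\min(i,c-j),0)\,\mu_1\ (i\ge1,\,j\ge0),\quad q((i,j),(i,j-1))=\min(c,j)\,\mu_2\ (i\ge0,\,j\ge1),$$ and assume that $X(0)=(0,0)$ almost surely. For $\alpha\in\mathbb C$ with $\operatorname{Re}\alpha>0$ let $\pi_x(\alpha)=\int_0^\infty e^{-\alpha t}\,\mathbb P(X(t)=x)\,dt$ (an absolutely convergent integral). Let $B$ be the busy period, started by one customer, of an $M/M/1$ queue with arrival rate $\lambda_2$ and service rate $c\mu_2$, and put $$\phi_2=\mathbb E\bigl[e^{-(\lambda_1+\alpha)B}\bigr],\quad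 \rho_2=\frac{\lambda_2}{c\mu_2},\quad r_2=\rho_2\phi_2,\quad \Omega_2=\frac{\rho_2\phi_2}{\lambda_2(1-\rho_2\phi_2^2)},\quad R_1=\frac{\lambda_1\Omega_2}{1-r_2\phi_2},\quad R_2=r_2\phi_2,$$ where $e^{-(\lambda_1+\alpha)B}=0$ on $\{B=\infty\}$. Then $1-r_2\phi_2\neq 0$ and, for all $i\ge0$ and $j\ge1$, $$\pi_{(i,c-1+j)}(\alpha)=\sum_{k=0}^i v_{i,k}\,(1-R_2)^k\binom{j-1+k}{k}r_2^j,$$ where the coefficients $v_{i,j}$, $0\le j\le i$, are given by $v_{0,0}=\pi_{(0,c-1)}(\alpha)$ and, for $i\ge0$, $$v_{i+1,0}=\pi_{(i+1,c-1)}(\alpha),\qquad v_{i+1,j}=R_1\Bigl(v_{i,j-1}+R_2\sum_{k=j}^{i}v_{i,k}\Bigr)\quad(1\le j\le i+1),$$ with empty sums equal to $0$. -/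

import Mathlib

open MeasureTheory Filter Topology Set
open scoped NNReal ENNReal

noncomputable section

/-- The conservative transition rate matrix with off-diagonal entries `r x y`: the diagonal entry
at `x` is minus the sum of the other entries of row `x`. -/
def rateMatrix {S : Type*} [DecidableEq S] (r : S → S → ℝ) (x y : S) : ℝ :=
  if x = y then -∑' z, (if z = x then 0 else r x z) else r x y

/-- `p` is a (honest, standard) transition function on the countable set `S`, with transition rate
matrix `q`: a semigroup of stochastic matrices with entrywise right derivative `q` at time `0`. -/
structure IsTransitionFunction {S : Type*} [DecidableEq S] (q : S → S → ℝ)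
    (p : ℝ≥0 → S → S → ℝ) : Prop where
  nonneg : ∀ t x y, 0 ≤ p t x y
  hasSum_one : ∀ t x, HasSum (fun y => p t x y) 1
  zero : ∀ x y, p 0 x y = if x = y then 1 else 0
  chapman_kolmogorov : ∀ s t x y, HasSum (fun z => p s x z * p t z y) (p (s + t) x y)
  rate : ∀ x y, Tendsto (fun h : ℝ≥0 => (p h x y - p 0 x y) / (h : ℝ)) (𝓝[>] 0) (𝓝 (q x y))

/-- `X` is a time-homogeneous continuous-time Markov chain with values in the countable set `S` and
with transition rate matrix `q`: the conditional law of `X (t (n + 1))`, given the values at earlier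
times `t 0 ≤ ⋯ ≤ t n`, is given by a transition function with rate matrix `q`. -/
structure IsCTMC {S Ω : Type*} [DecidableEq S] [MeasurableSpace Ω] (q : S → S → ℝ)
    (P : Measure Ω) (X : ℝ≥0 → Ω → S) : Prop where
  measurableSet_eq : ∀ t x, MeasurableSet {ω | X t ω = x}
  markov : ∃ p : ℝ≥0 → S → S → ℝ, IsTransitionFunction q p ∧
    ∀ (n : ℕ) (t : ℕ → ℝ≥0) (x : ℕ → S), Monotone t →
      P.real {ω | ∀ k ≤ n + 1, X (t k) ω = x k} =
        P.real {ω | ∀ k ≤ n, X (t k) ω = x k} * p (t (n + 1) - t n) (x n) (x (n + 1))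

/-- Almost all paths of `X` are right-continuous for the discrete topology on `S`. -/
def HasRightContPaths {S Ω : Type*} [MeasurableSpace Ω] (P : Measure Ω) (X : ℝ≥0 → Ω → S) : Prop :=
  ∀ᵐ ω ∂P, ∀ t : ℝ≥0, ∀ᶠ s in 𝓝[≥] t, X s ω = X t ω

/-- Off-diagonal transition rates of the two-class `M/M/c` queue with preemptive priority of class 2
over class 1. A state `(i, j)` means `i` class-1 and `j` class-2 customers in the system. -/
def priorityQueueRate (c : ℕ) (lam₁ lam₂ mu₁ mu₂ : ℝ) (x y : ℕ × ℕ) : ℝ :=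
  if y = (x.1 + 1, x.2) then lam₁
  else if y = (x.1, x.2 + 1) then lam₂
  else if x = (y.1 + 1, y.2) then max (min (x.1 : ℝ) ((c : ℝ) - (x.2 : ℝ))) 0 * mu₁
  else if x = (y.1, y.2 + 1) then min (c : ℝ) (x.2 : ℝ) * mu₂
  else 0

/-- Off-diagonal transition rates of the number of customers in an `M/M/1` queue. -/
def mm1Rate (lam mu : ℝ) (m n : ℕ) : ℝ :=
  if n = m + 1 then lam else if m = n + 1 then mu else 0

/-- The Laplace transform at `a` of the function `t ↦ P (X t = x)`. -/
def stateLaplace {S Ω : Type*} [MeasurableSpace Ω] (P : Measure Ω) (X : ℝ≥0 → Ω → S) (x : S)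
    (a : ℂ) : ℂ :=
  ∫ t in Ioi (0 : ℝ), Complex.exp (-(a * (t : ℂ))) * (P.real {ω | X t.toNNReal ω = x} : ℂ)

/-- The busy period: the first time at which the queue `Q` is empty (`⊤` if there is none). -/
def busyPeriod {Ω : Type*} (Q : ℝ≥0 → Ω → ℕ) (ω : Ω) : ℝ≥0∞ :=
  ⨅ (t : ℝ≥0) (_ : Q t ω = 0), (t : ℝ≥0∞)

/-- The Laplace-Stieltjes transform `E[exp (-a B)]` of the busy period `B` of `Q`, where
`exp (-a B) = 0` if `B = ⊤`. -/
def busyPeriodLST {Ω : Type*} [MeasurableSpace Ω] (P : Measure Ω) (Q : ℝ≥0 → Ω → ℕ) (a : ℂ) : ℂ :=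
  ∫ ω, (if busyPeriod Q ω = ⊤ then 0 else Complex.exp (-(a * ((busyPeriod Q ω).toReal : ℂ)))) ∂P

/-- The triangular array `v i j`, `j ≤ i`, of coefficients with first column `b`; the entries with
`j > i` are `0`. -/
def interiorCoeff (R₁ R₂ : ℂ) (b : ℕ → ℂ) : ℕ → ℕ → ℂ
  | 0, 0 => b 0
  | 0, _ + 1 => 0
  | i + 1, 0 => b (i + 1)
  | i + 1, j + 1 => R₁ * (interiorCoeff R₁ R₂ b i j +
      R₂ * ∑ k ∈ Finset.Icc (j + 1) i, interiorCoeff R₁ R₂ b i k)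

end

/-! The formula is a uniqueness statement for a linear recurrence. With at least `c` class-2
customers present no class-1 customer is served, so for `f i j = π (i, c - 1 + j)` the
Laplace-transformed forward equations above level `c - 1` read `A f i (j+1) = λ₁ f (i-1) (j+1) + λ₂
f i j + c μ₂ f i (j+2)`, where `A = λ₁ + α + λ₂ + c μ₂` and the `λ₁` term is absent for `i = 0`. Row
`i` is thus a second-order recurrence in `j`, with row `i - 1` as source. Its characteristic roots
are `r₂`, inside the unit disc, and `1/φ₂`, outside it. As `π` is bounded, the second mode is
excluded and the boundary value `f i 0` determines the row (`eq_zero_of_homogeneous`).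

A bounded solution is found by dividing by `r₂ ^ j`: what remains is a polynomial in `j`, and
comparing coefficients in the basis `(j - 1 + k).choose k` gives exactly the triangular recursion
for `v` (`reducedSolution_rec`).

The probabilistic inputs are the forward equation (`transitionLaplace_forward`), which holds because
the rates are bounded, and the identification of `φ₂` with the root `z` in the unit disc of the
busy-period quadratic (`busyPeriodLST_eq`). For the latter, `exp (-s t) z ^ Q t` stopped at the
empty state is a martingale. On a grid of step `h` this holds up to an error of order `h²` per step,
so only finite-dimensional laws are used before the mesh tends to zero. Since `Re (λ₁ + α) > 0`, no
stability condition is needed. -/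

/-! ### Elementary bounds for transition functions -/

namespace IsTransitionFunction

variable {S : Type*} [DecidableEq S] {q : S → S → ℝ} {p : ℝ≥0 → S → S → ℝ}

theorem le_one (hp : IsTransitionFunction q p) (t : ℝ≥0) (x y : S) : p t x y ≤ 1 :=
  le_hasSum (hp.hasSum_one t x) y fun z _ => hp.nonneg t x z

theorem add_le_one (hp : IsTransitionFunction q p) (t : ℝ≥0) {x y : S} (h : x ≠ y) :
    p t x x + p t x y ≤ 1 := by
  have := sum_le_hasSum {x, y} (fun z _ => hp.nonneg t x z) (hp.hasSum_one t x)
  rwa [Finset.sum_pair h] at this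

theorem diag_pow_le (hp : IsTransitionFunction q p) (t : ℝ≥0) (x : S) (n : ℕ) :
    p t x x ^ n ≤ p (n * t) x x := by
  induction n with
  | zero => simp [hp.zero]
  | succ n ih =>
    have h := le_hasSum (hp.chapman_kolmogorov (n * t) t x x) x
      fun z _ => mul_nonneg (hp.nonneg _ _ _) (hp.nonneg _ _ _)
    calc p t x x ^ (n + 1) = p t x x ^ n * p t x x := pow_succ _ _
      _ ≤ p (n * t) x x * p t x x := mul_le_mul_of_nonneg_right ih (hp.nonneg _ _ _)
      _ ≤ _ := h
      _ = _ := by push_cast; ring_nf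

/-- Chapman–Kolmogorov and Bernoulli give `p t x x ≥ (p (t/n) x x)^n ≥ 1 + n (p (t/n) x x - 1)`, and
the right side tends to `1 + t q x x`. A lower bound on the diagonal rates thus becomes a bound on
transition probabilities valid for all times, uniformly in the state. -/
theorem one_add_rate_le (hp : IsTransitionFunction q p) (t : ℝ≥0) (x : S) :
    1 + t * q x x ≤ p t x x := by
  rcases eq_or_ne t 0 with rfl | ht
  · simp [hp.zero]
  have ht' : 0 < t := pos_iff_ne_zero.2 ht
  have hlim : Tendsto (fun n : ℕ => t / ((n : ℝ≥0) + 1)) atTop (𝓝[>] 0) := by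
    refine tendsto_nhdsWithin_iff.2 ⟨?_, .of_forall fun n => by simp only [mem_Ioi]; positivity⟩
    rw [← NNReal.tendsto_coe]
    push_cast
    simpa [div_eq_mul_inv] using tendsto_one_div_add_atTop_nhds_zero_nat.const_mul (t : ℝ)
  have h := ((hp.rate x x).comp hlim).const_mul (t : ℝ) |>.const_add 1
  refine le_of_tendsto h (.of_forall fun n => ?_)
  have h1 := hp.diag_pow_le (t / ((n : ℝ≥0) + 1)) x (n + 1)
  have h2 := one_add_mul_le_pow (a := p (t / ((n : ℝ≥0) + 1)) x x - 1)
    (by linarith [hp.nonneg (t / ((n : ℝ≥0) + 1)) x x]) (n + 1)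
  have h3 : ((n + 1 : ℕ) : ℝ≥0) * (t / ((n : ℝ≥0) + 1)) = t := by
    push_cast; field_simp
  rw [h3] at h1
  rw [add_sub_cancel] at h2
  refine le_trans (le_of_eq ?_) (h2.trans h1)
  have ht0 : (t : ℝ) ≠ 0 := by exact_mod_cast ht
  simp only [Function.comp, hp.zero, if_true]
  push_cast
  field_simp

theorem one_sub_diag_le (hp : IsTransitionFunction q p) {K : ℝ} (hK : ∀ x, -K ≤ q x x)
    (t : ℝ≥0) (x : S) : 1 - p t x x ≤ K * t := by
  have := mul_le_mul_of_nonneg_left (hK x) t.2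
  have := hp.one_add_rate_le t x
  simp only [NNReal.val_eq_coe] at *
  linarith

theorem offDiag_le (hp : IsTransitionFunction q p) {K : ℝ} (hK : ∀ x, -K ≤ q x x)
    (t : ℝ≥0) {x y : S} (h : x ≠ y) : p t x y ≤ K * t := by
  linarith [hp.one_sub_diag_le hK t x, hp.add_le_one t h]

end IsTransitionFunction

/-! ### The semigroup on bounded functions -/

/-- The action of a transition function on complex functions. -/
noncomputable def transitionAct {S : Type*} (p : ℝ≥0 → S → S → ℝ) (t : ℝ≥0) (g : S → ℂ) (x : S) :
    ℂ := ∑' y, (p t x y : ℂ) * g y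

namespace IsTransitionFunction

variable {S : Type*} [DecidableEq S] {q : S → S → ℝ} {p : ℝ≥0 → S → S → ℝ} {g : S → ℂ} {M : ℝ}

theorem norm_mul_le (hp : IsTransitionFunction q p) (hg : ∀ x, ‖g x‖ ≤ M) (t : ℝ≥0) (x y : S) :
    ‖(p t x y : ℂ) * g y‖ ≤ p t x y * M := by
  rw [norm_mul, Complex.norm_real, Real.norm_of_nonneg (hp.nonneg _ _ _)]
  exact mul_le_mul_of_nonneg_left (hg y) (hp.nonneg _ _ _)

theorem summable_mul (hp : IsTransitionFunction q p) (hg : ∀ x, ‖g x‖ ≤ M) (t : ℝ≥0) (x : S) :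
    Summable fun y => (p t x y : ℂ) * g y :=
  .of_norm_bounded ((hp.hasSum_one t x).summable.mul_right M) (hp.norm_mul_le hg t x)

theorem hasSum_one_complex (hp : IsTransitionFunction q p) (t : ℝ≥0) (x : S) :
    HasSum (fun y => (p t x y : ℂ)) 1 := by
  simpa using (Complex.hasSum_ofReal (L := .unconditional S)).2 (hp.hasSum_one t x)

theorem norm_transitionAct_le (hp : IsTransitionFunction q p) (hg : ∀ x, ‖g x‖ ≤ M)
    (t : ℝ≥0) (x : S) : ‖transitionAct p t g x‖ ≤ M := by
  have := tsum_of_norm_bounded ((hp.hasSum_one t x).mul_right M) (hp.norm_mul_le hg t x)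
  rwa [one_mul] at this

theorem transitionAct_zero (hp : IsTransitionFunction q p) (g : S → ℂ) (x : S) :
    transitionAct p 0 g x = g x := by
  rw [transitionAct, tsum_eq_single x]
  · simp [hp.zero]
  · intro y hy
    simp [hp.zero, hy.symm]

theorem transitionAct_add (hp : IsTransitionFunction q p) (hg : ∀ x, ‖g x‖ ≤ M)
    (s t : ℝ≥0) (x : S) :
    transitionAct p (s + t) g x = transitionAct p s (transitionAct p t g) x := by
  have hM : 0 ≤ M := (norm_nonneg _).trans (hg x)
  -- Absolute summability over pairs, which justifies exchanging the two sums below.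
  have hsum : Summable fun w : S × S => (p s x w.1 : ℂ) * ((p t w.1 w.2 : ℂ) * g w.2) := by
    refine .of_norm_bounded (g := fun w : S × S => p s x w.1 * (p t w.1 w.2 * M)) ?_ ?_
    · refine (summable_prod_of_nonneg fun w =>
        mul_nonneg (hp.nonneg _ _ _) (mul_nonneg (hp.nonneg _ _ _) hM)).2 ⟨fun z => ?_, ?_⟩
      · exact ((hp.hasSum_one t z).summable.mul_right M).mul_left (p s x z)
      · refine ((hp.hasSum_one s x).summable.mul_right M).congr fun z => ?_
        dsimp only
        rw [tsum_mul_left, tsum_mul_right, (hp.hasSum_one t z).tsum_eq, one_mul]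
    · intro w
      rw [norm_mul, Complex.norm_real, Real.norm_of_nonneg (hp.nonneg _ _ _)]
      exact mul_le_mul_of_nonneg_left (hp.norm_mul_le hg _ _ _) (hp.nonneg _ _ _)
  have h1 : transitionAct p s (transitionAct p t g) x =
      ∑' z, ∑' y, (p s x z : ℂ) * ((p t z y : ℂ) * g y) := by
    simp only [transitionAct, tsum_mul_left]
  rw [h1, ← Summable.tsum_comm (f := fun y z => (p s x y : ℂ) * ((p t y z : ℂ) * g z)) hsum]
  refine tsum_congr fun y => ?_
  have h2 : HasSum (fun z => (p s x z : ℂ) * (p t z y : ℂ)) (p (s + t) x y : ℂ) := by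
    exact_mod_cast (Complex.hasSum_ofReal (L := .unconditional S)).2
      (hp.chapman_kolmogorov s t x y)
  rw [← h2.tsum_eq, ← tsum_mul_right]
  exact tsum_congr fun z => by ring

/-- Only the mass that has left `x`, at most `K t`, contributes, and there `g` varies by at most `2
M`. The uniformity in `x` supplies the dominating function for differentiating the semigroup. -/
theorem norm_transitionAct_sub_le (hp : IsTransitionFunction q p) {K : ℝ}
    (hK : ∀ x, -K ≤ q x x) (hg : ∀ x, ‖g x‖ ≤ M) (t : ℝ≥0) (x : S) :
    ‖transitionAct p t g x - g x‖ ≤ 2 * M * (K * t) := by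
  have hM : 0 ≤ M := (norm_nonneg _).trans (hg x)
  have h1 : HasSum (fun y => (p t x y : ℂ) * (g y - g x)) (transitionAct p t g x - g x) := by
    have := (hp.summable_mul hg t x).hasSum.sub ((hp.hasSum_one_complex t x).mul_right (g x))
    simp only [mul_sub]
    rwa [one_mul] at this
  have h2 : HasSum (fun y => (p t x y - if y = x then p t x x else 0) * (2 * M))
      ((1 - p t x x) * (2 * M)) :=
    ((hp.hasSum_one t x).sub (hasSum_ite_eq x (p t x x))).mul_right _
  rw [← h1.tsum_eq]
  refine (tsum_of_norm_bounded h2 fun y => ?_).trans ?_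
  · by_cases hy : y = x
    · subst hy; simp
    · simp only [hy, if_false, sub_zero]
      rw [norm_mul, Complex.norm_real, Real.norm_of_nonneg (hp.nonneg _ _ _)]
      refine mul_le_mul_of_nonneg_left ?_ (hp.nonneg _ _ _)
      linarith [norm_sub_le (g y) (g x), hg x, hg y]
  · rw [mul_comm]
    exact mul_le_mul_of_nonneg_left (hp.one_sub_diag_le hK t x) (by positivity)

theorem transitionAct_sub (hp : IsTransitionFunction q p) (hg : ∀ x, ‖g x‖ ≤ M)
    (t h : ℝ≥0) (x : S) :
    transitionAct p (t + h) g x - transitionAct p t g x =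
      ∑' z, (p t x z : ℂ) * (transitionAct p h g z - g z) := by
  rw [hp.transitionAct_add hg, transitionAct, transitionAct,
    ← (hp.summable_mul (hp.norm_transitionAct_le hg h) t x).tsum_sub (hp.summable_mul hg t x)]
  simp only [mul_sub]

/-- The difference quotient at `t` is `P_t` applied to the one at `0`. The latter converges
pointwise and is bounded by `2 M K`, so dominated convergence against the weights `p t x ·` applies.
-/
theorem hasDerivWithinAt_transitionAct (hp : IsTransitionFunction q p) {K : ℝ}
    (hK : ∀ x, -K ≤ q x x) (hg : ∀ x, ‖g x‖ ≤ M) {G : S → ℂ}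
    (hG : ∀ z, Tendsto (fun h : ℝ≥0 => (transitionAct p h g z - g z) / (h : ℂ)) (𝓝[>] 0)
      (𝓝 (G z))) (x : S) {t : ℝ} (ht : 0 ≤ t) :
    HasDerivWithinAt (fun t : ℝ => transitionAct p t.toNNReal g x)
      (transitionAct p t.toNNReal G x) (Ioi t) t := by
  rw [hasDerivWithinAt_iff_tendsto_slope' (by simp)]
  have hlim : Tendsto (fun u : ℝ => (u - t).toNNReal) (𝓝[>] t) (𝓝[>] 0) := by
    refine tendsto_nhdsWithin_iff.2 ⟨?_, ?_⟩
    · have : ContinuousAt (fun u : ℝ => (u - t).toNNReal) t := by fun_prop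
      simpa [ContinuousAt] using this.tendsto.mono_left nhdsWithin_le_nhds
    · filter_upwards [self_mem_nhdsWithin] with u hu
      simpa using hu
  have hmain : Tendsto (fun h : ℝ≥0 => ∑' z, (p t.toNNReal x z : ℂ) *
      ((transitionAct p h g z - g z) / (h : ℂ))) (𝓝[>] 0) (𝓝 (transitionAct p t.toNNReal G x)) := by
    refine tendsto_tsum_of_dominated_convergence
      (bound := fun z => p t.toNNReal x z * (2 * M * K))
      ((hp.hasSum_one t.toNNReal x).summable.mul_right _) (fun z => (hG z).const_mul _) ?_
    filter_upwards [self_mem_nhdsWithin] with h hh z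
    have hh' : (0 : ℝ) < h := hh
    rw [norm_mul, Complex.norm_real, Real.norm_of_nonneg (hp.nonneg _ _ _)]
    refine mul_le_mul_of_nonneg_left ?_ (hp.nonneg _ _ _)
    rw [norm_div, Complex.norm_real, Real.norm_of_nonneg hh'.le, div_le_iff₀ hh']
    linarith [hp.norm_transitionAct_sub_le hK hg h z]
  refine (hmain.comp hlim).congr' ?_
  filter_upwards [self_mem_nhdsWithin] with u hu
  have hu' : t < u := hu
  have h1 : u.toNNReal = t.toNNReal + (u - t).toNNReal := by
    rw [← Real.toNNReal_add ht (by linarith)]; congr 1; ring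
  rw [slope_def_module, h1, hp.transitionAct_sub hg, Function.comp]
  rw [Real.coe_toNNReal _ (by linarith : (0 : ℝ) ≤ u - t), ← tsum_const_smul'']
  refine tsum_congr fun z => ?_
  rw [Complex.real_smul]
  push_cast
  ring

theorem continuous_transitionAct (hp : IsTransitionFunction q p) {K : ℝ}
    (hK : ∀ x, -K ≤ q x x) (hg : ∀ x, ‖g x‖ ≤ M) (x : S) :
    Continuous (fun t : ℝ≥0 => transitionAct p t g x) := by
  have hM : 0 ≤ M := (norm_nonneg _).trans (hg x)
  have hle : ∀ t h : ℝ≥0, ‖transitionAct p (t + h) g x - transitionAct p t g x‖ ≤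
      2 * M * (K * h) := by
    intro t h
    have h2 := (hp.hasSum_one t x).mul_right (2 * M * (K * h))
    rw [one_mul] at h2
    rw [hp.transitionAct_sub hg]
    refine tsum_of_norm_bounded h2 fun z => ?_
    rw [norm_mul, Complex.norm_real, Real.norm_of_nonneg (hp.nonneg _ _ _)]
    exact mul_le_mul_of_nonneg_left (hp.norm_transitionAct_sub_le hK hg h z) (hp.nonneg _ _ _)
  have hd : ∀ t u : ℝ≥0, ‖transitionAct p t g x - transitionAct p u g x‖ ≤
      2 * M * |K| * dist t u := by
    have key : ∀ t u : ℝ≥0, t ≤ u → ‖transitionAct p u g x - transitionAct p t g x‖ ≤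
      2 * M * |K| * dist u t := by
      intro t u htu
      obtain ⟨h, rfl⟩ := exists_add_of_le htu
      refine (hle t h).trans ?_
      rw [NNReal.dist_eq]
      push_cast
      rw [add_sub_cancel_left, NNReal.abs_eq, ← mul_assoc]
      gcongr
      · exact le_abs_self K
    intro t u
    rcases le_total t u with h | h
    · rw [norm_sub_rev, dist_comm]; exact key t u h
    · exact key u t h
  refine LipschitzWith.continuous (K := (2 * M * |K|).toNNReal)
    (LipschitzWith.of_dist_le_mul fun t u => ?_)
  rw [dist_eq_norm, Real.coe_toNNReal _ (by positivity)]
  exact hd t u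

end IsTransitionFunction

/-! ### The forward equation and its Laplace transform -/

namespace IsTransitionFunction

variable {S : Type*} [DecidableEq S] {q : S → S → ℝ} {p : ℝ≥0 → S → S → ℝ}

theorem transitionAct_indicator (p : ℝ≥0 → S → S → ℝ) (t : ℝ≥0) (x y : S) :
    transitionAct p t (fun z => if z = y then 1 else 0) x = p t x y := by
  rw [transitionAct, tsum_eq_single y]
  · simp
  · intro z hz
    simp [hz]

theorem norm_indicator_le (y z : S) : ‖(if z = y then 1 else 0 : ℂ)‖ ≤ 1 := by
  split_ifs <;> simp

theorem continuous_apply (hp : IsTransitionFunction q p) {K : ℝ} (hK : ∀ x, -K ≤ q x x)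
    (x y : S) : Continuous fun t => (p t x y : ℂ) := by
  simpa only [transitionAct_indicator] using
    hp.continuous_transitionAct hK (norm_indicator_le y) x

/-- For the indicator of `y` the generator is column `y` of `q`, so differentiating the semigroup
yields the forward equation; the finite support of the column makes the sum finite. -/
theorem hasDerivWithinAt_apply (hp : IsTransitionFunction q p) {K : ℝ} (hK : ∀ x, -K ≤ q x x)
    {y : S} {F : Finset S} (hF : ∀ z ∉ F, q z y = 0) (x : S) {t : ℝ} (ht : 0 ≤ t) :
    HasDerivWithinAt (fun t : ℝ => (p t.toNNReal x y : ℂ))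
      (∑ z ∈ F, (p t.toNNReal x z : ℂ) * q z y) (Ioi t) t := by
  have h := hp.hasDerivWithinAt_transitionAct hK (norm_indicator_le y)
    (G := fun z => (q z y : ℂ)) (fun z => ?_) x ht
  · simp only [transitionAct_indicator] at h
    rwa [transitionAct, tsum_eq_sum (s := F) fun z hz => by simp [hF z hz]] at h
  · simp only [transitionAct_indicator]
    have := (Complex.continuous_ofReal.tendsto _).comp (hp.rate z y)
    refine this.congr fun h => ?_
    simp only [Function.comp, hp.zero]
    split_ifs <;> simp

/-- The Laplace transform of a transition function. -/
noncomputable def _root_.transitionLaplace (p : ℝ≥0 → S → S → ℝ) (a : ℂ) (x y : S) : ℂ :=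
  ∫ t in Ioi (0 : ℝ), Complex.exp (-(a * (t : ℂ))) * (p t.toNNReal x y : ℂ)

theorem norm_exp_neg_mul (a : ℂ) (t : ℝ) :
    ‖Complex.exp (-(a * (t : ℂ)))‖ = Real.exp (-a.re * t) := by
  rw [Complex.norm_exp]
  simp

theorem norm_laplace_integrand_le (hp : IsTransitionFunction q p) (a : ℂ) (x y : S) (t : ℝ) :
    ‖Complex.exp (-(a * (t : ℂ))) * (p t.toNNReal x y : ℂ)‖ ≤ Real.exp (-a.re * t) := by
  rw [norm_mul, norm_exp_neg_mul, Complex.norm_real, Real.norm_of_nonneg (hp.nonneg _ _ _)]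
  exact mul_le_of_le_one_right (Real.exp_pos _).le (hp.le_one _ _ _)

theorem continuous_laplace_integrand (hp : IsTransitionFunction q p) {K : ℝ}
    (hK : ∀ x, -K ≤ q x x) (a : ℂ) (x y : S) :
    Continuous fun t : ℝ => Complex.exp (-(a * (t : ℂ))) * (p t.toNNReal x y : ℂ) :=
  (by fun_prop : Continuous fun t : ℝ => Complex.exp (-(a * (t : ℂ)))).mul
    ((hp.continuous_apply hK x y).comp continuous_real_toNNReal)

theorem integrableOn_laplace (hp : IsTransitionFunction q p) {K : ℝ} (hK : ∀ x, -K ≤ q x x)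
    {a : ℂ} (ha : 0 < a.re) (x y : S) :
    IntegrableOn (fun t : ℝ => Complex.exp (-(a * (t : ℂ))) * (p t.toNNReal x y : ℂ)) (Ioi 0) :=
  (exp_neg_integrableOn_Ioi 0 ha).mono'
    (hp.continuous_laplace_integrand hK a x y).aestronglyMeasurable
    (.of_forall fun t => hp.norm_laplace_integrand_le a x y t)

theorem norm_transitionLaplace_le (hp : IsTransitionFunction q p) {a : ℂ} (ha : 0 < a.re)
    (x y : S) : ‖transitionLaplace p a x y‖ ≤ ∫ t in Ioi (0 : ℝ), Real.exp (-a.re * t) :=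
  norm_integral_le_of_norm_le (exp_neg_integrableOn_Ioi 0 ha)
    (.of_forall fun t => hp.norm_laplace_integrand_le a x y t)

/-- The Laplace transform of the Kolmogorov forward equation. -/
theorem transitionLaplace_forward (hp : IsTransitionFunction q p) {K : ℝ}
    (hK : ∀ x, -K ≤ q x x) {y : S} {F : Finset S} (hF : ∀ z ∉ F, q z y = 0) {a : ℂ}
    (ha : 0 < a.re) (x : S) :
    a * transitionLaplace p a x y - (if x = y then 1 else 0) =
      ∑ z ∈ F, transitionLaplace p a x z * q z y := by
  set f : S → ℝ → ℂ := fun z t => Complex.exp (-(a * (t : ℂ))) * (p t.toNNReal x z : ℂ) with hf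
  have hint : ∀ z, IntegrableOn (f z) (Ioi 0) := hp.integrableOn_laplace hK ha x
  have hcont : ∀ z, Continuous (f z) := hp.continuous_laplace_integrand hK a x
  set f' : ℝ → ℂ := fun t => ∑ z ∈ F, f z t * q z y - a * f y t with hf'
  have hint1 : IntegrableOn (fun t => ∑ z ∈ F, f z t * q z y) (Ioi 0) :=
    integrable_finsetSum _ fun z _ => (hint z).mul_const _
  have hint2 : IntegrableOn (fun t => a * f y t) (Ioi 0) := (hint y).const_mul _
  have hint' : IntegrableOn f' (Ioi 0) := hint1.sub hint2
  have hcont' : Continuous f' := by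
    refine (continuous_finsetSum _ fun z _ => (hcont z).mul continuous_const).sub
      (continuous_const.mul (hcont y))
  have hderiv : ∀ t : ℝ, 0 ≤ t → HasDerivWithinAt (f y) (f' t) (Ioi t) t := by
    intro t ht
    have h1 : HasDerivAt (fun t : ℝ => Complex.exp (-(a * (t : ℂ))))
        (Complex.exp (-(a * (t : ℂ))) * -(a * 1)) t :=
      (((Complex.ofRealCLM.hasDerivAt (x := t)).const_mul a).neg).cexp
    have h2 := h1.hasDerivWithinAt.mul (hp.hasDerivWithinAt_apply hK hF x ht)
    refine h2.congr_deriv ?_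
    simp only [hf', hf, Finset.mul_sum]
    rw [add_comm, sub_eq_add_neg]
    congr 1
    · exact Finset.sum_congr rfl fun z _ => by ring
    · ring
  -- A continuous function with a continuous right derivative is enough for the fundamental theorem;
  -- letting `T → ∞` leaves only the value at `0`.
  have hFTC : ∀ T : ℝ, 0 ≤ T → ∫ t in (0 : ℝ)..T, f' t = f y T - f y 0 := fun T hT =>
    intervalIntegral.integral_eq_sub_of_hasDeriv_right (hcont y).continuousOn
      (fun t ht => hderiv t (by simpa [hT] using ht.1.le))
      (hcont'.intervalIntegrable _ _)
  have hlim1 := intervalIntegral_tendsto_integral_Ioi 0 hint' tendsto_id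
  have hf0 : f y 0 = if x = y then 1 else 0 := by
    simp only [hf, Real.toNNReal_zero, hp.zero]
    split_ifs <;> simp
  have hlimf : Tendsto (f y) atTop (𝓝 0) := by
    refine squeeze_zero_norm (hp.norm_laplace_integrand_le a x y) ?_
    refine Real.tendsto_exp_atBot.comp ?_
    exact tendsto_id.const_mul_atTop_of_neg (by linarith)
  have hlim2 : Tendsto (fun T : ℝ => ∫ t in (0 : ℝ)..T, f' t) atTop
      (𝓝 (0 - if x = y then 1 else 0)) := by
    rw [← hf0]
    refine (hlimf.sub_const _).congr' ?_
    filter_upwards [eventually_ge_atTop 0] with T hT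
    exact (hFTC T hT).symm
  have heq := tendsto_nhds_unique hlim1 hlim2
  rw [hf', integral_sub hint1 hint2, integral_finsetSum _ fun z _ => (hint z).mul_const _,
    integral_const_mul] at heq
  simp only [integral_mul_const] at heq
  change ∑ z ∈ F, transitionLaplace p a x z * q z y - a * transitionLaplace p a x y = _ at heq
  linear_combination -heq

end IsTransitionFunction

/-! ### One-dimensional laws of the chain -/

namespace IsCTMC

variable {S Ω : Type*} [MeasurableSpace Ω] {P : Measure Ω}
  [IsProbabilityMeasure P] {X : ℝ≥0 → Ω → S}

theorem real_eq_transition {p : ℝ≥0 → S → S → ℝ}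
    (hmarkov : ∀ (n : ℕ) (t : ℕ → ℝ≥0) (x : ℕ → S), Monotone t →
      P.real {ω | ∀ k ≤ n + 1, X (t k) ω = x k} =
        P.real {ω | ∀ k ≤ n, X (t k) ω = x k} * p (t (n + 1) - t n) (x n) (x (n + 1)))
    {x₀ : S} (h0 : ∀ᵐ ω ∂P, X 0 ω = x₀) (t : ℝ≥0) (x : S) :
    P.real {ω | X t ω = x} = p t x₀ x := by
  -- The Markov property for the two times `0 ≤ t`; the time sequence is constant from index `1` on,
  -- to be monotone.
  have h := hmarkov 0 (fun k => if k = 0 then 0 else t) (fun k => if k = 0 then x₀ else x) ?_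
  · have h1 : P.real {ω | ∀ k ≤ 0, X (if k = 0 then 0 else t) ω = if k = 0 then x₀ else x} =
        1 := by
      rw [← probReal_univ (μ := P)]
      refine measureReal_congr ?_
      filter_upwards [h0] with ω hω
      refine eq_iff_iff.2 (iff_of_true ?_ trivial)
      intro k hk
      obtain rfl : k = 0 := by omega
      simpa using hω
    rw [h1] at h
    simp only [zero_add, one_ne_zero, if_false, if_true, tsub_zero, one_mul] at h
    rw [← h]
    refine measureReal_congr ?_
    filter_upwards [h0] with ω hω
    refine eq_iff_iff.2 ⟨fun hx k hk => ?_, fun hx => ?_⟩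
    · obtain rfl | rfl : k = 0 ∨ k = 1 := by omega
      · simpa using hω
      · simpa using show X t ω = x from hx
    · change X t ω = x
      simpa using hx 1 le_rfl
  · intro a b hab
    dsimp only
    split_ifs with h1 h2
    · rfl
    · exact zero_le
    · omega
    · rfl

end IsCTMC

/-! ### Rates and balance equations of the priority queue -/

section PriorityQueue

variable {c : ℕ} {lam₁ lam₂ mu₁ mu₂ : ℝ}

theorem priorityQueueRate_le (hlam₁ : 0 < lam₁) (hlam₂ : 0 < lam₂) (hmu₁ : 0 < mu₁)
    (hmu₂ : 0 < mu₂) (x y : ℕ × ℕ) :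
    priorityQueueRate c lam₁ lam₂ mu₁ mu₂ x y ≤ lam₁ + lam₂ + c * mu₁ + c * mu₂ := by
  have h1 : 0 ≤ (c : ℝ) * mu₁ := by positivity
  have h2 : 0 ≤ (c : ℝ) * mu₂ := by positivity
  have h3 : max (min (x.1 : ℝ) ((c : ℝ) - (x.2 : ℝ))) 0 * mu₁ ≤ c * mu₁ := by
    refine mul_le_mul_of_nonneg_right (max_le ((min_le_right _ _).trans ?_) ?_) hmu₁.le
    · linarith [(Nat.cast_nonneg x.2 : (0 : ℝ) ≤ x.2)]
    · positivity
  have h4 : min (c : ℝ) (x.2 : ℝ) * mu₂ ≤ c * mu₂ :=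
    mul_le_mul_of_nonneg_right (min_le_left _ _) hmu₂.le
  unfold priorityQueueRate
  split_ifs <;> linarith

theorem priorityQueueRate_eq_zero {x y : ℕ × ℕ}
    (h : y ∉ ({(x.1 + 1, x.2), (x.1, x.2 + 1), (x.1 - 1, x.2), (x.1, x.2 - 1)} :
      Finset (ℕ × ℕ))) :
    priorityQueueRate c lam₁ lam₂ mu₁ mu₂ x y = 0 := by
  obtain ⟨i, j⟩ := x
  obtain ⟨k, l⟩ := y
  simp only [Finset.mem_insert, Finset.mem_singleton, Prod.mk.injEq] at h
  unfold priorityQueueRate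
  simp only [Prod.mk.injEq]
  split_ifs <;> first | rfl | (exfalso; omega)

theorem rateMatrix_priorityQueue_diag_ge (hlam₁ : 0 < lam₁) (hlam₂ : 0 < lam₂) (hmu₁ : 0 < mu₁)
    (hmu₂ : 0 < mu₂) (x : ℕ × ℕ) :
    -(4 * (lam₁ + lam₂ + c * mu₁ + c * mu₂)) ≤
      rateMatrix (priorityQueueRate c lam₁ lam₂ mu₁ mu₂) x x := by
  set M := lam₁ + lam₂ + c * mu₁ + c * mu₂ with hM
  have hM0 : 0 ≤ M := by positivity
  rw [rateMatrix, if_pos rfl, neg_le_neg_iff, tsum_eq_sum (s := {(x.1 + 1, x.2), (x.1, x.2 + 1),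
    (x.1 - 1, x.2), (x.1, x.2 - 1)}) fun y hy => by simp [priorityQueueRate_eq_zero hy]]
  refine (Finset.sum_le_card_nsmul _ _ M fun y _ => ?_).trans ?_
  · split_ifs
    · exact hM0
    · exact priorityQueueRate_le hlam₁ hlam₂ hmu₁ hmu₂ x y
  · rw [nsmul_eq_mul]
    refine mul_le_mul_of_nonneg_right ?_ hM0
    exact_mod_cast Finset.card_le_four

theorem max_min_sub_eq_zero {a : ℝ} {j : ℕ} (hj : c ≤ j) :
    max (min a ((c : ℝ) - (j : ℝ))) 0 = 0 := by
  refine max_eq_right ((min_le_right _ _).trans ?_)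
  have : (c : ℝ) ≤ j := by exact_mod_cast hj
  linarith

theorem rateMatrix_priorityQueue_diag_eq {i j : ℕ} (hj : c ≤ j) (hc : 1 ≤ c) :
    rateMatrix (priorityQueueRate c lam₁ lam₂ mu₁ mu₂) (i, j) (i, j) =
      -(lam₁ + lam₂ + c * mu₂) := by
  have hj' : (c : ℝ) ≤ j := by exact_mod_cast hj
  obtain ⟨j, rfl⟩ : ∃ k, j = k + 1 := ⟨j - 1, by omega⟩
  rw [rateMatrix, if_pos rfl, neg_inj, tsum_eq_sum (s := {(i + 1, j + 1), (i, j + 2), (i, j)})]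
  · simp [priorityQueueRate]
    push_cast at hj'
    rw [min_eq_left hj', if_neg (by omega)]
    ring
  · rintro ⟨k, l⟩ h
    simp only [Finset.mem_insert, Finset.mem_singleton, Prod.mk.injEq] at h
    simp only [priorityQueueRate, Prod.mk.injEq, max_min_sub_eq_zero hj, zero_mul]
    split_ifs <;> first | rfl | (exfalso; omega)

theorem rateMatrix_priorityQueue_of_ne {x y : ℕ × ℕ} (h : x ≠ y) :
    rateMatrix (priorityQueueRate c lam₁ lam₂ mu₁ mu₂) x y =
      priorityQueueRate c lam₁ lam₂ mu₁ mu₂ x y := by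
  rw [rateMatrix, if_neg h]

/-- The target level satisfies `c ≤ j + 1`, so class-1 service does not enter this state. Nor does a
class-1 arrival, as there are no class-1 customers; the initial state contributes nothing because `j
+ 1 ≠ 0`. -/
theorem priorityQueue_laplace_zero {p : ℝ≥0 → ℕ × ℕ → ℕ × ℕ → ℝ}
    (hp : IsTransitionFunction (rateMatrix (priorityQueueRate c lam₁ lam₂ mu₁ mu₂)) p)
    (hc : 1 ≤ c) (hlam₁ : 0 < lam₁) (hlam₂ : 0 < lam₂) (hmu₁ : 0 < mu₁) (hmu₂ : 0 < mu₂)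
    {a : ℂ} (ha : 0 < a.re) {j : ℕ} (hj : c ≤ j + 1) :
    (a + lam₁ + lam₂ + c * mu₂) * transitionLaplace p a (0, 0) (0, j + 1) =
      lam₂ * transitionLaplace p a (0, 0) (0, j) +
      c * mu₂ * transitionLaplace p a (0, 0) (0, j + 2) := by
  have hj' : (c : ℝ) ≤ j + 2 := by
    have : (c : ℝ) ≤ j + 1 := by exact_mod_cast hj
    linarith
  have h := hp.transitionLaplace_forward
    (rateMatrix_priorityQueue_diag_ge hlam₁ hlam₂ hmu₁ hmu₂) (y := (0, j + 1))
    (F := {(0, j + 1), (0, j), (0, j + 2)}) ?_ ha (0, 0)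
  · rw [Finset.sum_insert (by simp), Finset.sum_insert (by simp), Finset.sum_singleton,
      rateMatrix_priorityQueue_diag_eq hj hc, rateMatrix_priorityQueue_of_ne (by simp),
      rateMatrix_priorityQueue_of_ne (by simp)] at h
    simp [priorityQueueRate, min_eq_left hj'] at h
    linear_combination h
  · rintro ⟨k, l⟩ h
    simp only [Finset.mem_insert, Finset.mem_singleton, Prod.mk.injEq] at h
    rw [rateMatrix_priorityQueue_of_ne (by simp; omega)]
    simp only [priorityQueueRate, Prod.mk.injEq]
    split_ifs <;> first
      | rfl
      | (exfalso; omega)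
      | tauto
      | rw [max_min_sub_eq_zero (by omega), zero_mul]

theorem priorityQueue_laplace_succ {p : ℝ≥0 → ℕ × ℕ → ℕ × ℕ → ℝ}
    (hp : IsTransitionFunction (rateMatrix (priorityQueueRate c lam₁ lam₂ mu₁ mu₂)) p)
    (hc : 1 ≤ c) (hlam₁ : 0 < lam₁) (hlam₂ : 0 < lam₂) (hmu₁ : 0 < mu₁) (hmu₂ : 0 < mu₂)
    {a : ℂ} (ha : 0 < a.re) (i : ℕ) {j : ℕ} (hj : c ≤ j + 1) :
    (a + lam₁ + lam₂ + c * mu₂) * transitionLaplace p a (0, 0) (i + 1, j + 1) =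
      lam₁ * transitionLaplace p a (0, 0) (i, j + 1) +
      lam₂ * transitionLaplace p a (0, 0) (i + 1, j) +
      c * mu₂ * transitionLaplace p a (0, 0) (i + 1, j + 2) := by
  have hj' : (c : ℝ) ≤ j + 2 := by
    have : (c : ℝ) ≤ j + 1 := by exact_mod_cast hj
    linarith
  have h := hp.transitionLaplace_forward
    (rateMatrix_priorityQueue_diag_ge hlam₁ hlam₂ hmu₁ hmu₂) (y := (i + 1, j + 1))
    (F := {(i + 1, j + 1), (i + 1, j), (i + 1, j + 2), (i, j + 1)}) ?_ ha (0, 0)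
  · rw [Finset.sum_insert (by simp), Finset.sum_insert (by simp), Finset.sum_insert (by simp),
      Finset.sum_singleton,
      rateMatrix_priorityQueue_diag_eq hj hc, rateMatrix_priorityQueue_of_ne (by simp),
      rateMatrix_priorityQueue_of_ne (by simp), rateMatrix_priorityQueue_of_ne (by simp)] at h
    simp [priorityQueueRate, min_eq_left hj'] at h
    linear_combination h
  · rintro ⟨k, l⟩ h
    simp only [Finset.mem_insert, Finset.mem_singleton, Prod.mk.injEq] at h
    rw [rateMatrix_priorityQueue_of_ne (by simp; omega)]
    simp only [priorityQueueRate, Prod.mk.injEq]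
    split_ifs <;> first
      | rfl
      | (exfalso; omega)
      | tauto
      | rw [max_min_sub_eq_zero (by omega), zero_mul]

end PriorityQueue

/-! ### The generator at a state with a finite conservative row -/

namespace IsTransitionFunction

variable {S : Type*} [DecidableEq S] {q : S → S → ℝ} {p : ℝ≥0 → S → S → ℝ} {g : S → ℂ} {M : ℝ}

/-- A conservative row with finite support acts as the generator on bounded functions. -/
theorem tendsto_transitionAct_of_finite_row (hp : IsTransitionFunction q p)
    (hg : ∀ x, ‖g x‖ ≤ M) {x : S} {F : Finset S} (hxF : x ∈ F) (hF : ∑ y ∈ F, q x y = 0) :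
    Tendsto (fun h : ℝ≥0 => (transitionAct p h g x - g x) / (h : ℂ)) (𝓝[>] 0)
      (𝓝 (∑ y ∈ F, (q x y : ℂ) * g y)) := by
  have hM : 0 ≤ M := (norm_nonneg _).trans (hg x)
  have h1 : Tendsto (fun h : ℝ≥0 => ∑ y ∈ F, (((p h x y - p 0 x y) / (h : ℝ) : ℝ) : ℂ) * g y)
      (𝓝[>] 0) (𝓝 (∑ y ∈ F, (q x y : ℂ) * g y)) :=
    tendsto_finsetSum _ fun y _ =>
      ((Complex.continuous_ofReal.tendsto _).comp (hp.rate x y)).mul_const _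
  -- The mass outside `F` at time `h` equals minus the change of the mass in `F`; it is `o(h)`
  -- because the row sums to zero over `F`.
  have h2 : Tendsto (fun h : ℝ≥0 => -(∑ y ∈ F, (p h x y - p 0 x y) / (h : ℝ)) * M)
      (𝓝[>] 0) (𝓝 0) := by
    have := ((tendsto_finsetSum F fun y _ => hp.rate x y).neg).mul_const M
    simpa [hF] using this
  have h0 : ∑ y ∈ F, p 0 x y = 1 := by
    simp [hp.zero, hxF]
  have h3 : Tendsto (fun h : ℝ≥0 => (transitionAct p h g x - g x) / (h : ℂ) -
      ∑ y ∈ F, (((p h x y - p 0 x y) / (h : ℝ) : ℝ) : ℂ) * g y) (𝓝[>] 0) (𝓝 0) := by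
    refine squeeze_zero_norm' ?_ h2
    filter_upwards [self_mem_nhdsWithin] with h hh
    have hh' : (0 : ℝ) < h := hh
    have hg0 : g x = ∑ y ∈ F, (p 0 x y : ℂ) * g y := by
      rw [Finset.sum_eq_single x (fun y _ hy => by simp [hp.zero, hy.symm])
        fun h => absurd hxF h]
      simp [hp.zero]
    have hsplit : ((transitionAct p h g x - g x) / (h : ℂ) -
        ∑ y ∈ F, (((p h x y - p 0 x y) / (h : ℝ) : ℝ) : ℂ) * g y) =
        (transitionAct p h g x - ∑ y ∈ F, (p h x y : ℂ) * g y) / (h : ℂ) := by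
      have : ∑ y ∈ F, (((p h x y - p 0 x y) / (h : ℝ) : ℝ) : ℂ) * g y =
          (∑ y ∈ F, (p h x y : ℂ) * g y - g x) / (h : ℂ) := by
        rw [hg0, ← Finset.sum_sub_distrib, Finset.sum_div]
        refine Finset.sum_congr rfl fun y _ => ?_
        push_cast
        ring
      rw [this]
      ring
    rw [hsplit, norm_div, Complex.norm_real, Real.norm_of_nonneg hh'.le, div_le_iff₀ hh']
    have hcompl : transitionAct p h g x - ∑ y ∈ F, (p h x y : ℂ) * g y =
        ∑' y : {y // y ∉ F}, (p h x y : ℂ) * g y := by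
      rw [transitionAct, ← (hp.summable_mul hg h x).sum_add_tsum_subtype_compl F]
      ring
    have hone : HasSum (fun y : {y // y ∉ F} => p h x y * M) ((1 - ∑ y ∈ F, p h x y) * M) := by
      refine HasSum.mul_right M ?_
      refine F.hasSum_compl_iff.2 ?_
      simpa using hp.hasSum_one h x
    rw [hcompl]
    refine (tsum_of_norm_bounded hone fun y => hp.norm_mul_le hg h x y).trans (le_of_eq ?_)
    rw [← Finset.sum_div, Finset.sum_sub_distrib, h0]
    field_simp
    ring
  simpa using h3.add h1

end IsTransitionFunction

/-! ### Powers as near-eigenfunctions of the `M/M/1` generator -/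

section MM1

variable {lam mu : ℝ}

theorem rateMatrix_mm1_of_ne {m n : ℕ} (h : m ≠ n) :
    rateMatrix (mm1Rate lam mu) m n = mm1Rate lam mu m n := by
  rw [rateMatrix, if_neg h]

theorem rateMatrix_mm1_zero : rateMatrix (mm1Rate lam mu) 0 0 = -lam := by
  rw [rateMatrix, if_pos rfl, tsum_eq_single 1]
  · simp [mm1Rate]
  · intro n hn
    simp [mm1Rate, hn]

theorem rateMatrix_mm1_succ (m : ℕ) :
    rateMatrix (mm1Rate lam mu) (m + 1) (m + 1) = -(lam + mu) := by
  rw [rateMatrix, if_pos rfl, tsum_eq_sum (s := {m + 2, m})]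
  · simp [mm1Rate, show m ≠ m + 1 + 1 by omega]
  · intro n hn
    simp only [Finset.mem_insert, Finset.mem_singleton] at hn
    simp only [mm1Rate]
    split_ifs <;> first | rfl | (exfalso; omega)

theorem rateMatrix_mm1_diag_ge (hmu : 0 < mu) (m : ℕ) :
    -(lam + mu) ≤ rateMatrix (mm1Rate lam mu) m m := by
  cases m with
  | zero => rw [rateMatrix_mm1_zero]; linarith
  | succ m => rw [rateMatrix_mm1_succ]

variable {p : ℝ≥0 → ℕ → ℕ → ℝ} {z s : ℂ}

theorem norm_pow_le_one_of_norm_le_one (hz : ‖z‖ ≤ 1) (n : ℕ) : ‖z ^ n‖ ≤ 1 := by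
  rw [norm_pow]
  exact pow_le_one₀ (norm_nonneg _) hz

/-- Away from `0` the eigenvalue relation with eigenvalue `s` is `z ^ (m - 1)` times the quadratic
equation. At `0` no service takes place, which leaves the defect `lam * (z - 1) - s`. -/
theorem mm1_tendsto_generator_pow (hp : IsTransitionFunction (rateMatrix (mm1Rate lam mu)) p)
    (hz : ‖z‖ ≤ 1) (hroot : (s + lam + mu) * z = mu + lam * z ^ 2) (m : ℕ) :
    Tendsto (fun h : ℝ≥0 => (transitionAct p h (fun n => z ^ n) m - z ^ m) / (h : ℂ)) (𝓝[>] 0)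
      (𝓝 (s * z ^ m + (lam * (z - 1) - s) * if m = 0 then 1 else 0)) := by
  cases m with
  | zero =>
    have h := hp.tendsto_transitionAct_of_finite_row (norm_pow_le_one_of_norm_le_one hz) (x := 0)
      (F := {0, 1}) (by simp) (by
        rw [Finset.sum_pair (by simp), rateMatrix_mm1_zero, rateMatrix_mm1_of_ne (by simp)]
        simp [mm1Rate])
    convert h using 2
    rw [Finset.sum_pair (by simp), rateMatrix_mm1_zero, rateMatrix_mm1_of_ne (by simp)]
    simp [mm1Rate]
    ring
  | succ m =>
    have h := hp.tendsto_transitionAct_of_finite_row (norm_pow_le_one_of_norm_le_one hz)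
      (x := m + 1) (F := {m + 1, m + 2, m}) (by simp) (by
        rw [Finset.sum_insert (by simp), Finset.sum_pair (by simp), rateMatrix_mm1_succ,
          rateMatrix_mm1_of_ne (by simp), rateMatrix_mm1_of_ne (by simp)]
        simp [mm1Rate, show m ≠ m + 1 + 1 by omega])
    convert h using 2
    rw [Finset.sum_insert (by simp), Finset.sum_pair (by simp), rateMatrix_mm1_succ,
      rateMatrix_mm1_of_ne (by simp), rateMatrix_mm1_of_ne (by simp)]
    simp [mm1Rate, show m ≠ m + 1 + 1 by omega]
    linear_combination z ^ m * hroot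

/-- Up to second order in `h`, the function `m ↦ z ^ m` is an eigenfunction of the transition
operator outside the empty state. -/
theorem mm1_norm_discounted_sub_le (hp : IsTransitionFunction (rateMatrix (mm1Rate lam mu)) p)
    (hlam : 0 < lam) (hmu : 0 < mu) (hs : 0 ≤ s.re) (hz : ‖z‖ ≤ 1)
    (hroot : (s + lam + mu) * z = mu + lam * z ^ 2) {m : ℕ} (hm : m ≠ 0) (h : ℝ≥0) :
    ‖Complex.exp (-(s * (h : ℝ))) * transitionAct p h (fun n => z ^ n) m - z ^ m‖ ≤
      ‖lam * (z - 1) - s‖ * (lam + mu) * h ^ 2 := by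
  set κ : ℂ := lam * (z - 1) - s with hκ
  have hg := norm_pow_le_one_of_norm_le_one hz
  have hK := rateMatrix_mm1_diag_ge (lam := lam) hmu
  set u : ℝ → ℂ := fun t => Complex.exp (-(s * (t : ℂ))) *
    transitionAct p t.toNNReal (fun n => z ^ n) m with hu
  have hcont : Continuous u :=
    (by fun_prop : Continuous fun t : ℝ => Complex.exp (-(s * (t : ℂ)))).mul
      ((hp.continuous_transitionAct hK hg m).comp continuous_real_toNNReal)
  have hderiv : ∀ t ∈ Ico (0 : ℝ) h, HasDerivWithinAt u
      (Complex.exp (-(s * (t : ℂ))) * (κ * p t.toNNReal m 0)) (Ici t) t := by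
    intro t ht
    rw [← hasDerivWithinAt_Ioi_iff_Ici]
    have h1 : HasDerivAt (fun t : ℝ => Complex.exp (-(s * (t : ℂ))))
        (Complex.exp (-(s * (t : ℂ))) * -(s * 1)) t :=
      (((Complex.ofRealCLM.hasDerivAt (x := t)).const_mul s).neg).cexp
    have h2 := hp.hasDerivWithinAt_transitionAct hK hg (mm1_tendsto_generator_pow hp hz hroot)
      m ht.1
    have h3 : transitionAct p t.toNNReal
        (fun n => s * z ^ n + κ * if n = 0 then 1 else 0) m =
        s * transitionAct p t.toNNReal (fun n => z ^ n) m + κ * p t.toNNReal m 0 := by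
      have e1 := (hp.summable_mul hg t.toNNReal m).hasSum.mul_left s
      have e2 := (hp.summable_mul (IsTransitionFunction.norm_indicator_le 0)
        t.toNNReal m).hasSum.mul_left κ
      have e3 := (e1.add e2).tsum_eq
      rw [← IsTransitionFunction.transitionAct_indicator, transitionAct, transitionAct,
        transitionAct, ← e3]
      exact tsum_congr fun n => by ring
    rw [h3] at h2
    refine (h1.hasDerivWithinAt.mul h2).congr_deriv ?_
    ring
  have hbound : ∀ t ∈ Ico (0 : ℝ) h,
      ‖Complex.exp (-(s * (t : ℂ))) * (κ * p t.toNNReal m 0)‖ ≤ ‖κ‖ * ((lam + mu) * h) := by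
    intro t ht
    rw [norm_mul, norm_mul, IsTransitionFunction.norm_exp_neg_mul, Complex.norm_real,
      Real.norm_of_nonneg (hp.nonneg _ _ _)]
    have e1 : Real.exp (-s.re * t) ≤ 1 := by
      rw [Real.exp_le_one_iff]
      nlinarith [ht.1]
    -- The defect is felt only at `0`, reached from `m ≠ 0` with probability `O(t)`; integrating
    -- over `[0, h]` makes the error of order `h²`.
    have e2 := hp.offDiag_le hK t.toNNReal hm
    rw [Real.coe_toNNReal _ ht.1] at e2
    have e3 : (lam + mu) * t ≤ (lam + mu) * h :=
      mul_le_mul_of_nonneg_left ht.2.le (by positivity)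
    have e4 := hp.nonneg t.toNNReal m 0
    refine (mul_le_of_le_one_left (by positivity) e1).trans ?_
    exact mul_le_mul_of_nonneg_left (e2.trans e3) (norm_nonneg _)
  have := norm_image_sub_le_of_norm_deriv_right_le_segment hcont.continuousOn hderiv hbound h
    ⟨h.2, le_rfl⟩
  simp only [hu, Real.toNNReal_coe, Real.toNNReal_zero, hp.transitionAct_zero] at this
  refine le_trans (le_of_eq ?_) (this.trans (le_of_eq ?_))
  · simp
  · ring

end MM1

/-! ### The Markov property for functions of the path -/

namespace IsCTMC

variable {S Ω : Type*} [DecidableEq S] [Countable S] [MeasurableSpace S]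
  [MeasurableSingletonClass S] [MeasurableSpace Ω] {q : S → S → ℝ} {P : Measure Ω}
  [IsProbabilityMeasure P] {X : ℝ≥0 → Ω → S}

/-- The Markov property for a bounded function of the next value, on an event that is determined
by finitely many earlier values. -/
theorem integral_cylinder (hmeas : ∀ t x, MeasurableSet {ω | X t ω = x}) {p : ℝ≥0 → S → S → ℝ}
    (hp : IsTransitionFunction q p)
    (hmarkov : ∀ (n : ℕ) (t : ℕ → ℝ≥0) (x : ℕ → S), Monotone t →
      P.real {ω | ∀ k ≤ n + 1, X (t k) ω = x k} =
        P.real {ω | ∀ k ≤ n, X (t k) ω = x k} * p (t (n + 1) - t n) (x n) (x (n + 1)))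
    {g : S → ℂ} {M : ℝ} (hg : ∀ x, ‖g x‖ ≤ M) {n : ℕ} {t : ℕ → ℝ≥0} (ht : Monotone t)
    {w : (Fin (n + 1) → S) → ℂ} {M' : ℝ} (hw : ∀ e, ‖w e‖ ≤ M') :
    ∫ ω, w (fun k => X (t k) ω) * g (X (t (n + 1)) ω) ∂P =
      ∫ ω, w (fun k => X (t k) ω) * transitionAct p (t (n + 1) - t n) g (X (t n) ω) ∂P := by
  have hXm : ∀ t, Measurable (X t) := fun t => measurable_to_countable' fun x => hmeas t x
  set Y : Ω → (Fin (n + 1) → S) := fun ω k => X (t k) ω with hY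
  have hYm : Measurable Y := measurable_pi_lambda _ fun k => hXm _
  have hZm : Measurable fun ω => (Y ω, X (t (n + 1)) ω) := hYm.prodMk (hXm _)
  -- History and next value take countably many values, so their joint law is determined by its
  -- atoms, and the Markov property factorises these.
  have hjoint : ∀ e y, (P.map fun ω => (Y ω, X (t (n + 1)) ω)).real {(e, y)} =
      (P.map Y).real {e} * p (t (n + 1) - t n) (e (Fin.last n)) y := by
    intro e y
    rw [map_measureReal_apply hZm (measurableSet_singleton _),
      map_measureReal_apply hYm (measurableSet_singleton _)]
    have h := hmarkov n t (fun k => if h : k < n + 1 then e ⟨k, h⟩ else y) ht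
    have h1 : {ω | ∀ k ≤ n + 1, X (t k) ω = if h : k < n + 1 then e ⟨k, h⟩ else y} =
        (fun ω => (Y ω, X (t (n + 1)) ω)) ⁻¹' {(e, y)} := by
      ext ω
      simp only [mem_ofPred_eq, mem_preimage, mem_singleton_iff, Prod.mk.injEq, funext_iff, hY]
      refine ⟨fun H => ⟨fun k => ?_, ?_⟩, fun H k hk => ?_⟩
      · have := H k (by omega)
        rwa [dif_pos k.2] at this
      · have := H (n + 1) le_rfl
        rwa [dif_neg (by omega)] at this
      · split_ifs with hk'
        · exact H.1 ⟨k, hk'⟩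
        · obtain rfl : k = n + 1 := by omega
          exact H.2
    have h2 : {ω | ∀ k ≤ n, X (t k) ω = if h : k < n + 1 then e ⟨k, h⟩ else y} =
        Y ⁻¹' {e} := by
      ext ω
      simp only [mem_ofPred_eq, mem_preimage, mem_singleton_iff, funext_iff, hY]
      refine ⟨fun H k => ?_, fun H k hk => ?_⟩
      · have := H k (by omega)
        rwa [dif_pos k.2] at this
      · rw [dif_pos (by omega)]
        exact H ⟨k, by omega⟩
    rw [h1, h2, dif_pos (by omega), dif_neg (by omega)] at h
    exact h
  have hM' : 0 ≤ M' := by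
    obtain ⟨ω⟩ : Nonempty Ω := nonempty_of_isProbabilityMeasure P
    exact (norm_nonneg _).trans (hw (Y ω))
  have : IsProbabilityMeasure (P.map fun ω => (Y ω, X (t (n + 1)) ω)) :=
    Measure.isProbabilityMeasure_map hZm.aemeasurable
  have : IsProbabilityMeasure (P.map Y) := Measure.isProbabilityMeasure_map hYm.aemeasurable
  have hint1 : Integrable (fun v : (Fin (n + 1) → S) × S => w v.1 * g v.2)
      (P.map fun ω => (Y ω, X (t (n + 1)) ω)) := by
    refine .of_bound (measurable_of_countable _).aestronglyMeasurable (M' * M)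
      (.of_forall fun v => ?_)
    rw [norm_mul]
    exact mul_le_mul (hw _) (hg _) (norm_nonneg _) hM'
  have hint2 : Integrable (fun e : Fin (n + 1) → S =>
      w e * transitionAct p (t (n + 1) - t n) g (e (Fin.last n))) (P.map Y) := by
    refine .of_bound (measurable_of_countable _).aestronglyMeasurable (M' * M)
      (.of_forall fun v => ?_)
    rw [norm_mul]
    exact mul_le_mul (hw _) (hp.norm_transitionAct_le hg _ _) (norm_nonneg _) hM'
  have e1 := integral_map hZm.aemeasurable hint1.aestronglyMeasurable
  have e2 := integral_map hYm.aemeasurable hint2.aestronglyMeasurable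
  have e3 := integral_countable hint1
  have e4 := integral_countable hint2
  have hsum : Summable fun v : (Fin (n + 1) → S) × S =>
      (P.map fun ω => (Y ω, X (t (n + 1)) ω)).real {v} • (w v.1 * g v.2) := by
    rw [← Measure.sum_smul_dirac (P.map fun ω => (Y ω, X (t (n + 1)) ω))] at hint1
    refine .of_norm (hint1.summable_of_dirac.congr fun v => ?_)
    rw [norm_smul, Real.norm_of_nonneg measureReal_nonneg, measureReal_def]
  rw [e3, hsum.tsum_prod] at e1
  rw [e4] at e2
  refine e1.symm.trans (Eq.trans ?_ e2)
  refine tsum_congr fun e => ?_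
  simp only [hjoint, Complex.real_smul]
  rw [transitionAct, ← tsum_mul_left, ← tsum_mul_left]
  refine tsum_congr fun y => ?_
  push_cast
  ring

end IsCTMC

/-! ### Approximating the busy period on a grid -/

section StoppedQueue

variable {Ω : Type*} {Q : ℝ≥0 → Ω → ℕ} {z s : ℂ} {h : ℝ≥0}

open scoped Classical in
/-- The process `exp (-s t) * z ^ Q t` observed on the grid of step `h` and stopped when `Q` is
seen to vanish. -/
noncomputable def stoppedDiscount (Q : ℝ≥0 → Ω → ℕ) (z s : ℂ) (h : ℝ≥0) : ℕ → Ω → ℂ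
  | 0, ω => z ^ Q 0 ω
  | k + 1, ω => if ∀ j ≤ k, Q (j * h) ω ≠ 0 then
      Complex.exp (-(s * (((k + 1 : ℕ) * h : ℝ≥0) : ℝ))) * z ^ Q ((k + 1 : ℕ) * h) ω
    else stoppedDiscount Q z s h k ω

theorem stoppedDiscount_of_ne_zero {k : ℕ} {ω : Ω} (hk : ∀ j < k, Q (j * h) ω ≠ 0) :
    stoppedDiscount Q z s h k ω = Complex.exp (-(s * ((k * h : ℝ≥0) : ℝ))) * z ^ Q (k * h) ω := by
  cases k with
  | zero => simp [stoppedDiscount]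
  | succ k => rw [stoppedDiscount, if_pos fun j hj => hk j (by omega)]

theorem stoppedDiscount_of_eq_zero {m k : ℕ} {ω : Ω} (hm : ∀ j < m, Q (j * h) ω ≠ 0)
    (hm0 : Q (m * h) ω = 0) (hmk : m ≤ k) :
    stoppedDiscount Q z s h k ω = Complex.exp (-(s * ((m * h : ℝ≥0) : ℝ))) := by
  induction k, hmk using Nat.le_induction with
  | base => rw [stoppedDiscount_of_ne_zero hm, hm0, pow_zero, mul_one]
  | succ k hk ih => rw [stoppedDiscount, if_neg fun H => H m hk hm0, ih]

theorem norm_exp_le_one (hs : 0 ≤ s.re) (t : ℝ≥0) : ‖Complex.exp (-(s * (t : ℝ)))‖ ≤ 1 := by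
  rw [IsTransitionFunction.norm_exp_neg_mul, Real.exp_le_one_iff]
  nlinarith [t.2]

theorem norm_stoppedDiscount_le (hs : 0 ≤ s.re) (hz : ‖z‖ ≤ 1) (k : ℕ) (ω : Ω) :
    ‖stoppedDiscount Q z s h k ω‖ ≤ 1 := by
  induction k with
  | zero => exact norm_pow_le_one_of_norm_le_one hz _
  | succ k ih =>
    rw [stoppedDiscount]
    split_ifs
    · rw [norm_mul]
      exact mul_le_one₀ (norm_exp_le_one hs _) (norm_nonneg _) (norm_pow_le_one_of_norm_le_one hz _)
    · exact ih

theorem measurable_stoppedDiscount [MeasurableSpace Ω] (hQ : ∀ t, Measurable (Q t)) (k : ℕ) :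
    Measurable (stoppedDiscount Q z s h k) := by
  induction k with
  | zero => exact (measurable_of_countable fun n : ℕ => z ^ n).comp (hQ 0)
  | succ k ih =>
    refine Measurable.ite ?_ ?_ ih
    · have : {ω | ∀ j ≤ k, Q (j * h) ω ≠ 0} = ⋂ j ∈ Finset.range (k + 1), Q (j * h) ⁻¹' {0}ᶜ := by
        ext ω
        simp
      rw [this]
      exact Finset.measurableSet_biInter _ fun j _ => hQ _ (measurableSet_singleton 0).compl
    · exact ((measurable_of_countable fun n : ℕ => z ^ n).comp (hQ _)).const_mul _

/-- On paths that are right-continuous, the stopped grid process approximates the discount factor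
at the hitting time of the empty state. -/
theorem exists_stoppedDiscount_eq {ω : Ω} {b u : ℝ≥0} (hb : ∀ t < b, Q t ω ≠ 0)
    (hu : ∀ t ∈ Ico b u, Q t ω = 0) (hh : 0 < h) (hbu : b + h ≤ u) {k : ℕ} (hk : b + h ≤ k * h) :
    ∃ τ : ℝ≥0, b ≤ τ ∧ τ ≤ b + h ∧
      stoppedDiscount Q z s h k ω = Complex.exp (-(s * (τ : ℝ))) := by
  have h1 : b ≤ ⌈b / h⌉₊ * h := (div_le_iff₀ hh).1 (Nat.le_ceil _)
  have h2 : (⌈b / h⌉₊ : ℝ≥0) * h < b + h := by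
    have := mul_lt_mul_of_pos_right (Nat.ceil_lt_add_one (zero_le : 0 ≤ b / h)) hh
    rwa [add_mul, one_mul, div_mul_cancel₀ _ hh.ne'] at this
  -- The first grid point at or after `b`. It overshoots by less than `h`, so it still lies in the
  -- empty interval `[b, u)`.
  refine ⟨⌈b / h⌉₊ * h, h1, h2.le, stoppedDiscount_of_eq_zero (fun j hj => hb _ ?_)
    (hu _ ⟨h1, h2.trans_le hbu⟩) ?_⟩
  · exact (lt_div_iff₀ hh).1 (Nat.lt_ceil.1 hj)
  · have := lt_of_mul_lt_mul_right (h2.trans_le hk) hh.le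
    exact_mod_cast this.le

theorem busyPeriod_le {ω : Ω} {t : ℝ≥0} (ht : Q t ω = 0) : busyPeriod Q ω ≤ t :=
  iInf₂_le t ht

theorem ne_zero_of_busyPeriod_eq_top {ω : Ω} (hB : busyPeriod Q ω = ⊤) (t : ℝ≥0) : Q t ω ≠ 0 := by
  intro ht
  have := busyPeriod_le ht
  rw [hB] at this
  simp at this

/-- Right-continuity makes the infimum attained and keeps the queue empty for a positive time, so a
fine enough grid cannot miss the visit to `0`. -/
theorem exists_of_busyPeriod_ne_top {ω : Ω} (hcont : ∀ t : ℝ≥0, ∀ᶠ s in 𝓝[≥] t, Q s ω = Q t ω)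
    {b : ℝ≥0} (hB : busyPeriod Q ω = b) :
    (∀ t < b, Q t ω ≠ 0) ∧ ∃ u > b, ∀ t ∈ Ico b u, Q t ω = 0 := by
  have h1 : ∀ t < b, Q t ω ≠ 0 := fun t ht h0 => by
    have := busyPeriod_le h0
    rw [hB, ENNReal.coe_le_coe] at this
    exact this.not_gt ht
  refine ⟨h1, ?_⟩
  obtain ⟨u, hu, hsub⟩ := (mem_nhdsGE_iff_exists_Ico_subset).1 (hcont b)
  have hu' : b < u := hu
  have hQb : Q b ω = 0 := by
    by_contra hne
    have : (u : ℝ≥0∞) ≤ busyPeriod Q ω := by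
      refine le_iInf₂ fun t ht => ?_
      rw [ENNReal.coe_le_coe]
      by_contra! htu
      rcases lt_or_ge t b with htb | htb
      · exact h1 t htb ht
      · have h3 : Q t ω = Q b ω := hsub ⟨htb, htu⟩
        exact hne (h3 ▸ ht)
    rw [hB, ENNReal.coe_le_coe] at this
    exact this.not_gt hu'
  exact ⟨u, hu', fun t ht => (show Q t ω = Q b ω from hsub ht).trans hQb⟩

/-- The grid step used in the approximation of the busy period. -/
noncomputable def gridStep (n : ℕ) : ℝ≥0 := 1 / ((n : ℝ≥0) + 1) ^ 2

theorem gridStep_pos (n : ℕ) : 0 < gridStep n := by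
  unfold gridStep
  positivity

theorem gridStep_mul (n : ℕ) : (((n + 1) ^ 3 : ℕ) : ℝ≥0) * gridStep n = n + 1 := by
  unfold gridStep
  push_cast
  field_simp

theorem tendsto_gridStep : Tendsto gridStep atTop (𝓝 0) := by
  have h1 : Tendsto (fun n : ℕ => (1 / ((n : ℝ) + 1)) ^ 2) atTop (𝓝 (0 ^ 2)) :=
    tendsto_one_div_add_atTop_nhds_zero_nat.pow 2
  rw [← NNReal.tendsto_coe]
  refine (by simpa using h1 : Tendsto (fun n : ℕ => (((n : ℝ) + 1) ^ 2)⁻¹) atTop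
    (𝓝 0)).congr fun n => ?_
  simp [gridStep]

/-- The mesh tends to `0` while the horizon `n + 1` grows. On a path that never empties, the modulus
is at most `exp (-(n + 1) Re s)`. -/
theorem tendsto_stoppedDiscount {ω : Ω}
    (hcont : ∀ t : ℝ≥0, ∀ᶠ s in 𝓝[≥] t, Q s ω = Q t ω) (hs : 0 < s.re) (hz : ‖z‖ ≤ 1) :
    Tendsto (fun n : ℕ => stoppedDiscount Q z s (gridStep n) ((n + 1) ^ 3) ω) atTop
      (𝓝 (if busyPeriod Q ω = ⊤ then 0
        else Complex.exp (-(s * ((busyPeriod Q ω).toReal : ℂ))))) := by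
  split_ifs with hB
  · have hlim : Tendsto (fun n : ℕ => Real.exp (-s.re * ((n : ℝ) + 1))) atTop (𝓝 0) := by
      refine Real.tendsto_exp_atBot.comp ?_
      exact (tendsto_natCast_atTop_atTop.atTop_add tendsto_const_nhds).const_mul_atTop_of_neg
        (by linarith)
    refine squeeze_zero_norm (fun n => ?_) hlim
    rw [stoppedDiscount_of_ne_zero fun j _ => ne_zero_of_busyPeriod_eq_top hB _, norm_mul,
      IsTransitionFunction.norm_exp_neg_mul, gridStep_mul]
    push_cast
    exact mul_le_of_le_one_right (Real.exp_pos _).le (norm_pow_le_one_of_norm_le_one hz _)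
  · lift busyPeriod Q ω to ℝ≥0 using hB with b hb
    obtain ⟨hlt, u, hu, hu0⟩ := exists_of_busyPeriod_ne_top hcont hb.symm
    have hev : ∀ᶠ n : ℕ in atTop, ∃ τ : ℝ≥0, b ≤ τ ∧ τ ≤ b + gridStep n ∧
        stoppedDiscount Q z s (gridStep n) ((n + 1) ^ 3) ω = Complex.exp (-(s * (τ : ℝ))) := by
      have h1 : Tendsto (fun n => b + gridStep n) atTop (𝓝 b) := by
        simpa using tendsto_gridStep.const_add b
      have h2 : Tendsto (fun n : ℕ => (n : ℝ≥0) + 1) atTop atTop :=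
        tendsto_atTop_mono (fun n => le_self_add) tendsto_natCast_atTop_atTop
      filter_upwards [h1.eventually_lt_const hu, h1.eventually_lt_const (lt_add_one b),
        h2.eventually_ge_atTop (b + 1)] with n hn1 hn2 hn3
      refine exists_stoppedDiscount_eq hlt hu0 (gridStep_pos n) hn1.le ?_
      rw [gridStep_mul]
      exact hn2.le.trans hn3
    obtain ⟨N, hN⟩ := eventually_atTop.1 hev
    choose! τ h1 h2 h3 using hN
    have hτ : Tendsto τ atTop (𝓝 b) := by
      refine tendsto_of_tendsto_of_tendsto_of_le_of_le' tendsto_const_nhds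
        (h := fun n => b + gridStep n) (by simpa using tendsto_gridStep.const_add b) ?_ ?_
      · filter_upwards [eventually_ge_atTop N] with n hn using h1 n hn
      · filter_upwards [eventually_ge_atTop N] with n hn using h2 n hn
    have hexp : Continuous fun t : ℝ≥0 => Complex.exp (-(s * ((t : ℝ) : ℂ))) := by fun_prop
    refine ((hexp.tendsto b).comp hτ).congr' ?_
    filter_upwards [eventually_ge_atTop N] with n hn
    exact (h3 n hn).symm

end StoppedQueue

/-! ### The busy-period transform as a root of a quadratic -/

section BusyPeriod

variable {Ω : Type*} [MeasurableSpace Ω] {P : Measure Ω} [IsProbabilityMeasure P]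
  {Q : ℝ≥0 → Ω → ℕ} {lam mu : ℝ} {z s : ℂ}

theorem integrable_stoppedDiscount (hQ : ∀ t, Measurable (Q t)) (hs : 0 ≤ s.re) (hz : ‖z‖ ≤ 1)
    (h : ℝ≥0) (k : ℕ) : Integrable (stoppedDiscount Q z s h k) P :=
  .of_bound (measurable_stoppedDiscount hQ k).aestronglyMeasurable 1
    (.of_forall fun ω => norm_stoppedDiscount_le hs hz k ω)

open scoped Classical in
-- Nothing changes once the grid has seen the empty state. Otherwise the Markov property replaces
-- the next value by the semigroup at a nonzero state, where the discounted power is preserved up to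
-- order `h²`.
theorem norm_integral_stoppedDiscount_succ_sub_le {p : ℝ≥0 → ℕ → ℕ → ℝ}
    (hmeas : ∀ t x, MeasurableSet {ω | Q t ω = x})
    (hp : IsTransitionFunction (rateMatrix (mm1Rate lam mu)) p)
    (hmarkov : ∀ (n : ℕ) (t : ℕ → ℝ≥0) (x : ℕ → ℕ), Monotone t →
      P.real {ω | ∀ k ≤ n + 1, Q (t k) ω = x k} =
        P.real {ω | ∀ k ≤ n, Q (t k) ω = x k} * p (t (n + 1) - t n) (x n) (x (n + 1)))
    (hlam : 0 < lam) (hmu : 0 < mu) (hs : 0 ≤ s.re) (hz : ‖z‖ ≤ 1)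
    (hroot : (s + lam + mu) * z = mu + lam * z ^ 2) (h : ℝ≥0) (k : ℕ) :
    ‖∫ ω, stoppedDiscount Q z s h (k + 1) ω ∂P - ∫ ω, stoppedDiscount Q z s h k ω ∂P‖ ≤
      ‖lam * (z - 1) - s‖ * (lam + mu) * h ^ 2 := by
  have hQ : ∀ t, Measurable (Q t) := fun t => measurable_to_countable' fun x => hmeas t x
  have hg := norm_pow_le_one_of_norm_le_one hz
  set E : ℝ≥0 → ℂ := fun t => Complex.exp (-(s * (t : ℝ))) with hE
  have hEadd : E ((k + 1 : ℕ) * h) = E (k * h) * E h := by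
    simp only [hE]
    rw [← Complex.exp_add]
    congr 1
    push_cast
    ring
  set w : (Fin (k + 1) → ℕ) → ℂ := fun e => if ∀ j, e j ≠ 0 then E (k * h) else 0 with hw
  have hw1 : ∀ e, ‖w e‖ ≤ 1 := by
    intro e
    simp only [hw]
    split_ifs
    · exact norm_exp_le_one hs _
    · simp
  have hmono : Monotone fun j : ℕ => (j : ℝ≥0) * h := fun a b hab => by
    dsimp only
    gcongr
  have hM := IsCTMC.integral_cylinder hmeas hp hmarkov hg hmono hw1
  have hstep : ((k + 1 : ℕ) : ℝ≥0) * h - k * h = h := by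
    push_cast
    rw [add_mul, one_mul, add_tsub_cancel_left]
  rw [hstep] at hM
  set W : Ω → ℂ := fun ω => w fun j => Q (j * h) ω with hW
  have hYm : Measurable fun ω => fun j : Fin (k + 1) => Q (j * h) ω :=
    measurable_pi_lambda _ fun j => hQ _
  have hWm : Measurable W := (measurable_of_countable w).comp hYm
  have hint : ∀ (f : ℕ → ℂ) (_ : ∀ n, ‖f n‖ ≤ 1) (t : ℝ≥0),
      Integrable (fun ω => W ω * f (Q t ω)) P := fun f hf t =>
    .of_bound (hWm.mul ((measurable_of_countable f).comp (hQ t))).aestronglyMeasurable 1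
      (.of_forall fun ω => by
        rw [norm_mul]
        exact mul_le_one₀ (hw1 _) (norm_nonneg _) (hf _))
  have hdiff : ∀ ω, stoppedDiscount Q z s h (k + 1) ω - stoppedDiscount Q z s h k ω =
      E h * (W ω * z ^ Q ((k + 1 : ℕ) * h) ω) - W ω * z ^ Q (k * h) ω := by
    intro ω
    rw [stoppedDiscount]
    by_cases hA : ∀ j ≤ k, Q (j * h) ω ≠ 0
    · have hWω : W ω = E (k * h) := if_pos fun j : Fin (k + 1) => hA j (Nat.lt_succ_iff.1 j.2)
      rw [if_pos hA, hWω, stoppedDiscount_of_ne_zero fun j hj => hA j hj.le]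
      change E _ * _ - E _ * _ = _
      rw [hEadd]
      ring
    · have hWω : W ω = 0 := if_neg fun H => hA fun j hj => H ⟨j, Nat.lt_succ_iff.2 hj⟩
      rw [if_neg hA, hWω]
      ring
  rw [← integral_sub (integrable_stoppedDiscount hQ hs hz h _)
    (integrable_stoppedDiscount hQ hs hz h _)]
  simp only [hdiff]
  rw [integral_sub ((hint _ hg _).const_mul _) (hint _ hg _), integral_const_mul, hM,
    ← integral_const_mul,
    ← integral_sub ((hint _ (hp.norm_transitionAct_le hg h) _).const_mul _) (hint _ hg _)]
  refine (norm_integral_le_of_norm_le_const (C := ‖lam * (z - 1) - s‖ * (lam + mu) * h ^ 2)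
    (.of_forall fun ω => ?_)).trans (by simp)
  by_cases hA : ∀ j : Fin (k + 1), Q (j * h) ω ≠ 0
  · rw [show E h * (W ω * transitionAct p h (fun n => z ^ n) (Q (k * h) ω)) -
        W ω * z ^ Q (k * h) ω = W ω * (E h * transitionAct p h (fun n => z ^ n) (Q (k * h) ω) -
        z ^ Q (k * h) ω) by ring, norm_mul]
    have h0 : Q (k * h) ω ≠ 0 := by simpa using hA (Fin.last k)
    exact (mul_le_of_le_one_left (norm_nonneg _) (hw1 _)).trans
      (mm1_norm_discounted_sub_le hp hlam hmu hs hz hroot h0 h)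
  · have hWω : W ω = 0 := if_neg hA
    rw [hWω]
    simp only [zero_mul, mul_zero, sub_zero, norm_zero]
    positivity

/-- The transform of the busy period of an `M/M/1` queue is the root in the closed unit disc of
its quadratic equation. -/
theorem busyPeriodLST_eq (hQ : IsCTMC (rateMatrix (mm1Rate lam mu)) P Q)
    (hcont : HasRightContPaths P Q) (hQ0 : ∀ᵐ ω ∂P, Q 0 ω = 1)
    (hlam : 0 < lam) (hmu : 0 < mu) (hs : 0 < s.re) (hz : ‖z‖ ≤ 1)
    (hroot : (s + lam + mu) * z = mu + lam * z ^ 2) : busyPeriodLST P Q s = z := by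
  obtain ⟨hmeas, p, hp, hmarkov⟩ := hQ
  have hQm : ∀ t, Measurable (Q t) := fun t => measurable_to_countable' fun x => hmeas t x
  set C := ‖lam * (z - 1) - s‖ * (lam + mu) with hC
  have hbound : ∀ (h : ℝ≥0) (k : ℕ), ‖∫ ω, stoppedDiscount Q z s h k ω ∂P - z‖ ≤
      k * (C * h ^ 2) := by
    intro h k
    induction k with
    | zero =>
      have : ∫ ω, stoppedDiscount Q z s h 0 ω ∂P = z := by
        have : stoppedDiscount Q z s h 0 =ᵐ[P] fun _ => z := by
          filter_upwards [hQ0] with ω hω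
          simp [stoppedDiscount, hω]
        rw [integral_congr_ae this]
        simp
      simp [this]
    | succ k ih =>
      have h1 := norm_integral_stoppedDiscount_succ_sub_le hmeas hp hmarkov hlam hmu hs.le hz
        hroot h k
      have h2 := norm_add_le (∫ ω, stoppedDiscount Q z s h (k + 1) ω ∂P -
        ∫ ω, stoppedDiscount Q z s h k ω ∂P) (∫ ω, stoppedDiscount Q z s h k ω ∂P - z)
      rw [sub_add_sub_cancel] at h2
      push_cast
      linarith
  have hlim1 : Tendsto (fun n : ℕ => ∫ ω, stoppedDiscount Q z s (gridStep n) ((n + 1) ^ 3) ω ∂P)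
      atTop (𝓝 z) := by
    rw [tendsto_iff_norm_sub_tendsto_zero]
    -- There are `(n+1)^3` steps with error `C (n+1)^(-4)` each, so the total is `C / (n+1)`.
    refine squeeze_zero (fun _ => norm_nonneg _) (fun n => hbound _ _) ?_
    have := tendsto_one_div_add_atTop_nhds_zero_nat.const_mul C
    rw [mul_zero] at this
    refine this.congr fun n => ?_
    simp only [gridStep]
    push_cast
    field_simp
  have hlim2 : Tendsto (fun n : ℕ => ∫ ω, stoppedDiscount Q z s (gridStep n) ((n + 1) ^ 3) ω ∂P)
      atTop (𝓝 (busyPeriodLST P Q s)) := by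
    refine tendsto_integral_of_dominated_convergence (fun _ => 1)
      (fun n => (measurable_stoppedDiscount hQm _).aestronglyMeasurable) (integrable_const 1)
      (fun n => .of_forall fun ω => norm_stoppedDiscount_le hs.le hz _ ω) ?_
    filter_upwards [hcont] with ω hω
    exact tendsto_stoppedDiscount hω hs hz
  exact tendsto_nhds_unique hlim2 hlim1

/-- The quadratic equation of the busy period has a root in the open unit disc, and so is the
reciprocal of its other root. -/
theorem exists_busyPeriod_root (hlam : 0 < lam) (hmu : 0 < mu) (hs : 0 < s.re) :
    ∃ z : ℂ, ‖z‖ < 1 ∧ lam * ‖z‖ < mu ∧ (s + lam + mu) * z = mu + lam * z ^ 2 := by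
  have hlamC : (lam : ℂ) ≠ 0 := by exact_mod_cast hlam.ne'
  have hmuC : (mu : ℂ) ≠ 0 := by exact_mod_cast hmu.ne'
  -- As `Re s > 0`, the triangle inequality gives `(‖z‖ - 1)(lam ‖z‖ - mu) > 0` for every root. The
  -- product of the roots is `mu / lam`, so an outer root `z` has the inner companion `mu / (lam
  -- z)`.
  have hdich : ∀ z : ℂ, (s + lam + mu) * z = mu + lam * z ^ 2 →
      (‖z‖ < 1 ∧ lam * ‖z‖ < mu) ∨ (1 < ‖z‖ ∧ mu < lam * ‖z‖) := by
    intro z hz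
    have hz0 : z ≠ 0 := by
      rintro rfl
      exact hmuC (by simpa using hz.symm)
    have hpos : 0 < ‖z‖ := norm_pos_iff.2 hz0
    have h1 : lam + mu < ‖s + lam + mu‖ := by
      refine lt_of_lt_of_le ?_ (Complex.re_le_norm _)
      simp
      linarith
    have h2 : ‖s + lam + mu‖ * ‖z‖ ≤ mu + lam * ‖z‖ ^ 2 := by
      rw [← norm_mul, hz]
      refine (norm_add_le _ _).trans (le_of_eq ?_)
      rw [norm_mul, norm_pow, Complex.norm_real, Complex.norm_real, Real.norm_of_nonneg hmu.le,
        Real.norm_of_nonneg hlam.le]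
    have h3 := mul_lt_mul_of_pos_right h1 hpos
    have h4 : 0 < (‖z‖ - 1) * (lam * ‖z‖ - mu) := by nlinarith
    rcases pos_and_pos_or_neg_and_neg_of_mul_pos h4 with h | h
    · exact .inr ⟨by linarith, by linarith⟩
    · exact .inl ⟨by linarith, by linarith⟩
  obtain ⟨d, hd⟩ := IsAlgClosed.exists_pow_nat_eq
    (discrim (lam : ℂ) (-(s + lam + mu)) mu) (n := 2) (by norm_num)
  obtain ⟨z, hz⟩ := exists_quadratic_eq_zero hlamC ⟨d, by rw [← hd, sq]⟩
  have hz1 : (s + lam + mu) * z = mu + lam * z ^ 2 := by linear_combination -hz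
  rcases hdich z hz1 with h | h
  · exact ⟨z, h.1, h.2, hz1⟩
  · have hz0 : z ≠ 0 := by
      rintro rfl
      exact hmuC (by simpa using hz1.symm)
    have hz2 : (s + lam + mu) * (mu / (lam * z)) = mu + lam * (mu / (lam * z)) ^ 2 := by
      field_simp
      linear_combination hz1
    rcases hdich _ hz2 with h' | h'
    · exact ⟨_, h'.1, h'.2, hz2⟩
    · exfalso
      rw [norm_div, norm_mul, Complex.norm_real, Complex.norm_real, Real.norm_of_nonneg hmu.le,
        Real.norm_of_nonneg hlam.le, one_lt_div (by nlinarith)] at h'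
      linarith [h.2, h'.1]

end BusyPeriod

/-! ### Identities for the triangular array and binomials -/

section InteriorCoeff

variable {R₁ R₂ : ℂ} {b : ℕ → ℂ}

theorem interiorCoeff_zero (i : ℕ) : interiorCoeff R₁ R₂ b i 0 = b i := by
  cases i <;> rw [interiorCoeff]

/-- A weighted tail sum of one row is a multiple of a plain tail sum of the row before. -/
theorem sum_interiorCoeff_mul_pow {i m : ℕ} (him : m ≤ i) :
    ∑ k ∈ Finset.Icc m i, interiorCoeff R₁ R₂ b (i + 1) (k + 1) * (1 - R₂) ^ (k + 1) =
      R₁ * (1 - R₂) ^ (m + 1) * ∑ k ∈ Finset.Icc m i, interiorCoeff R₁ R₂ b i k := by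
  -- Adding the term of index `m` to the tail combines the weights `R₂` and `1 - R₂` of the old tail
  -- into `1`.
  induction him using Nat.decreasingInduction with
  | self =>
    simp [interiorCoeff]
    ring
  | of_succ m hm ih =>
    rw [← Finset.insert_Icc_succ_left_eq_Icc hm.le, Finset.sum_insert (by simp),
      Finset.sum_insert (by simp), Order.succ_eq_add_one, ih, interiorCoeff]
    ring

/-- The tail sum built into the recursion is exactly what cancels the `R₂` term, leaving one entry
of the previous row. This is the coefficient comparison behind `reducedSolution_rec`. -/
theorem interiorCoeff_succ_sub {i m : ℕ} (him : m ≤ i) :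
    interiorCoeff R₁ R₂ b (i + 1) (m + 1) * (1 - R₂) ^ (m + 1) -
      R₂ * ∑ k ∈ Finset.Icc m i, interiorCoeff R₁ R₂ b (i + 1) (k + 1) * (1 - R₂) ^ (k + 1) =
      R₁ * (1 - R₂) ^ 2 * (interiorCoeff R₁ R₂ b i m * (1 - R₂) ^ m) := by
  rw [sum_interiorCoeff_mul_pow him, ← Finset.insert_Icc_succ_left_eq_Icc him,
    Finset.sum_insert (by simp), Order.succ_eq_add_one, interiorCoeff]
  ring

end InteriorCoeff

theorem choose_add_eq_sum_choose (j k : ℕ) :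
    ((j + 1 + k).choose k : ℂ) = ∑ m ∈ Finset.range (k + 1), ((j + m).choose m : ℂ) := by
  induction k with
  | zero => simp
  | succ k ih =>
    rw [Finset.sum_range_succ, ← ih]
    have h : (j + 1 + (k + 1)).choose (k + 1) =
        (j + 1 + k).choose k + (j + (k + 1)).choose (k + 1) := by
      rw [← add_assoc, Nat.choose_succ_succ]
      congr 2
      omega
    rw [h]
    push_cast
    ring

/-- A bounded solution of the homogeneous difference equation with zero initial value vanishes. -/
theorem eq_zero_of_homogeneous {A l m r φ : ℂ} {d : ℕ → ℂ} {M : ℝ} (hφ : ‖φ‖ < 1) (hm : m ≠ 0)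
    (hr : m * r = l * φ) (hroot : A * φ = m + l * φ ^ 2) (hd : ∀ j, ‖d j‖ ≤ M) (hd0 : d 0 = 0)
    (hrec : ∀ j, A * d (j + 1) = l * d j + m * d (j + 2)) (j : ℕ) : d j = 0 := by
  -- The operator factors over the roots `r` and `1/φ`. The quantity `d (j+1) - r * d j` lies in the
  -- mode `1/φ`, which grows unless it vanishes.
  have h1 : ∀ j, d (j + 1) - r * d j = φ * (d (j + 2) - r * d (j + 1)) := by
    intro j
    refine mul_left_cancel₀ hm ?_
    linear_combination φ * hrec j - d (j + 1) * hroot - (d j - φ * d (j + 1)) * hr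
  have h2 : ∀ n j, d (j + 1) - r * d j = φ ^ n * (d (j + n + 1) - r * d (j + n)) := by
    intro n
    induction n with
    | zero => simp
    | succ n ih =>
      intro j
      rw [ih j, h1 (j + n), pow_succ]
      ring_nf
  have h3 : ∀ j, d (j + 1) - r * d j = 0 := by
    intro j
    have hlim : Tendsto (fun n : ℕ => ‖φ‖ ^ n * (M + ‖r‖ * M)) atTop (𝓝 0) := by
      simpa using (tendsto_pow_atTop_nhds_zero_of_lt_one (norm_nonneg φ) hφ).mul_const (M + ‖r‖ * M)
    refine norm_le_zero_iff.1 (ge_of_tendsto hlim (.of_forall fun n => ?_))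
    rw [h2 n j, norm_mul, norm_pow]
    refine mul_le_mul_of_nonneg_left ((norm_sub_le _ _).trans ?_) (by positivity)
    rw [norm_mul]
    exact add_le_add (hd _) (mul_le_mul_of_nonneg_left (hd _) (norm_nonneg _))
  induction j with
  | zero => exact hd0
  | succ j ih => simpa [ih] using h3 j

theorem exists_norm_choose_mul_pow_le {r : ℂ} (hr : ‖r‖ < 1) (k : ℕ) :
    ∃ M : ℝ, ∀ j, ‖((j + k).choose k : ℂ) * r ^ (j + 1)‖ ≤ M := by
  have h := (summable_choose_mul_geometric_of_norm_lt_one k hr).tendsto_atTop_zero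
  obtain ⟨M, hM⟩ := h.norm.bddAbove_range
  refine ⟨M, fun j => ?_⟩
  rw [pow_succ, ← mul_assoc, norm_mul]
  exact (mul_le_of_le_one_right (norm_nonneg _) hr.le).trans (hM ⟨j, rfl⟩)

/-! ### Solving the difference equations -/

section Solution

variable {R₁ R₂ r : ℂ} {b : ℕ → ℂ}

/-- The candidate solution of the difference equations above the boundary level. -/
noncomputable def interiorSolution (R₁ R₂ r : ℂ) (b : ℕ → ℂ) (i : ℕ) : ℕ → ℂ
  | 0 => b i
  | j + 1 => ∑ k ∈ Finset.range (i + 1),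
      interiorCoeff R₁ R₂ b i k * (1 - R₂) ^ k * ((j + k).choose k : ℂ) * r ^ (j + 1)

theorem exists_norm_interiorSolution_le (hr : ‖r‖ < 1) (i : ℕ) :
    ∃ M : ℝ, ∀ j, ‖interiorSolution R₁ R₂ r b i j‖ ≤ M := by
  choose B hB using exists_norm_choose_mul_pow_le hr
  refine ⟨max ‖b i‖ (∑ k ∈ Finset.range (i + 1),
    ‖interiorCoeff R₁ R₂ b i k * (1 - R₂) ^ k‖ * B k), fun j => ?_⟩
  cases j with
  | zero => exact le_max_left _ _
  | succ j =>
    refine le_max_of_le_right ((norm_sum_le _ _).trans (Finset.sum_le_sum fun k _ => ?_))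
    rw [mul_assoc, norm_mul]
    exact mul_le_mul_of_nonneg_left (hB k j) (norm_nonneg _)

variable {A l m φ a : ℂ}

/-- If `φ` solves the quadratic, so does `m / (l φ) = 1 / r`, and reciprocals of its roots solve the
reversed quadratic. -/
theorem char_equation (hm : m ≠ 0) (hφ : φ ≠ 0) (hr : m * r = l * φ)
    (hroot : A * φ = m + l * φ ^ 2) : A * r = l + m * r ^ 2 := by
  refine mul_left_cancel₀ (mul_ne_zero hm hφ) ?_
  linear_combination m * r * hroot + (m - m * φ * r) * hr

theorem interiorSolution_zero_rec (hm : m ≠ 0) (hφ : φ ≠ 0) (hr : m * r = l * φ)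
    (hroot : A * φ = m + l * φ ^ 2) (j : ℕ) :
    A * interiorSolution R₁ R₂ r b 0 (j + 1) =
      l * interiorSolution R₁ R₂ r b 0 j + m * interiorSolution R₁ R₂ r b 0 (j + 2) := by
  have hA := char_equation hm hφ hr hroot
  have hval : ∀ j, interiorSolution R₁ R₂ r b 0 j = b 0 * r ^ j := by
    intro j
    cases j <;> simp [interiorSolution, interiorCoeff]
  simp only [hval]
  linear_combination b 0 * r ^ j * hA

/-- The solution divided by `r ^ j`. -/
noncomputable def reducedSolution (R₁ R₂ : ℂ) (b : ℕ → ℂ) (i : ℕ) : ℕ → ℂ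
  | 0 => b i
  | j + 1 => ∑ k ∈ Finset.range (i + 1),
      interiorCoeff R₁ R₂ b i k * (1 - R₂) ^ k * ((j + k).choose k : ℂ)

theorem interiorSolution_eq (i j : ℕ) :
    interiorSolution R₁ R₂ r b i j = reducedSolution R₁ R₂ b i j * r ^ j := by
  cases j with
  | zero => simp [interiorSolution, reducedSolution]
  | succ j => rw [interiorSolution, reducedSolution, Finset.sum_mul]

/-- By Pascal's rule a difference in `j` lowers the binomial degree by one. The separate value `b i`
at `j = 0` fits the pattern, since there only the term `k = 0` would survive. -/
theorem reducedSolution_succ_sub (i j : ℕ) :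
    reducedSolution R₁ R₂ b (i + 1) (j + 1) - reducedSolution R₁ R₂ b (i + 1) j =
      ∑ k ∈ Finset.range (i + 1), interiorCoeff R₁ R₂ b (i + 1) (k + 1) * (1 - R₂) ^ (k + 1) *
        ((j + k).choose k : ℂ) := by
  cases j with
  | zero =>
    rw [reducedSolution.eq_1, reducedSolution.eq_2, Finset.sum_range_succ' _ (i + 1),
      interiorCoeff_zero]
    simp
  | succ j =>
    rw [reducedSolution, reducedSolution, ← Finset.sum_sub_distrib, Finset.sum_range_succ']
    simp only [Nat.choose_zero_right, sub_self, add_zero]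
    refine Finset.sum_congr rfl fun k _ => ?_
    rw [← mul_sub, choose_add_eq_sum_choose j (k + 1), Finset.sum_range_succ,
      ← choose_add_eq_sum_choose, add_sub_cancel_right]

theorem reducedSolution_rec (i j : ℕ) :
    (reducedSolution R₁ R₂ b (i + 1) (j + 1) - reducedSolution R₁ R₂ b (i + 1) j) -
      R₂ * (reducedSolution R₁ R₂ b (i + 1) (j + 2) -
        reducedSolution R₁ R₂ b (i + 1) (j + 1)) =
      R₁ * (1 - R₂) ^ 2 * reducedSolution R₁ R₂ b i (j + 1) := by
  rw [reducedSolution_succ_sub, reducedSolution_succ_sub, reducedSolution]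
  have h : ∑ k ∈ Finset.range (i + 1), interiorCoeff R₁ R₂ b (i + 1) (k + 1) *
      (1 - R₂) ^ (k + 1) * ((j + 1 + k).choose k : ℂ) =
      ∑ n ∈ Finset.range (i + 1), ((j + n).choose n : ℂ) *
        ∑ k ∈ Finset.Icc n i, interiorCoeff R₁ R₂ b (i + 1) (k + 1) * (1 - R₂) ^ (k + 1) := by
    simp only [choose_add_eq_sum_choose j, Finset.mul_sum]
    -- After the hockey-stick expansion both sides are expressed in the basis `(j + n).choose n`;
    -- swapping the sums turns its coefficients into tail sums.
    rw [Finset.sum_comm' (t' := Finset.range (i + 1)) (s' := fun n => Finset.Icc n i)]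
    · exact Finset.sum_congr rfl fun n _ => Finset.sum_congr rfl fun k _ => mul_comm _ _
    · intro k n
      simp only [Finset.mem_range, Finset.mem_Icc]
      omega
  rw [h, Finset.mul_sum, Finset.mul_sum, ← Finset.sum_sub_distrib]
  refine Finset.sum_congr rfl fun n hn => ?_
  linear_combination ((j + n).choose n : ℂ) *
    interiorCoeff_succ_sub (R₁ := R₁) (R₂ := R₂) (b := b)
      (Nat.lt_succ_iff.1 (Finset.mem_range.1 hn))

/-- Dividing by `r ^ j` and using the characteristic equation together with `m r² = l R₂` leaves
`reducedSolution_rec`; `hR₁` matches the source term. -/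
theorem interiorSolution_succ_rec (hm : m ≠ 0) (hφ : φ ≠ 0) (hr : m * r = l * φ)
    (hroot : A * φ = m + l * φ ^ 2) (hR₂ : R₂ = r * φ) (hR₁ : l * (R₁ * (1 - R₂) ^ 2) = a * r)
    (i j : ℕ) :
    A * interiorSolution R₁ R₂ r b (i + 1) (j + 1) =
      a * interiorSolution R₁ R₂ r b i (j + 1) + l * interiorSolution R₁ R₂ r b (i + 1) j +
        m * interiorSolution R₁ R₂ r b (i + 1) (j + 2) := by
  have hA := char_equation hm hφ hr hroot
  have hrec := reducedSolution_rec (R₁ := R₁) (R₂ := R₂) (b := b) i j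
  simp only [interiorSolution_eq]
  set u := reducedSolution R₁ R₂ b (i + 1)
  set u' := reducedSolution R₁ R₂ b i
  have hr2 : m * r ^ 2 = l * R₂ := by
    rw [hR₂]
    linear_combination r * hr
  linear_combination r ^ j * u (j + 1) * hA + r ^ j * l * hrec + r ^ j * u' (j + 1) * hR₁ -
    r ^ j * (u (j + 2) - u (j + 1)) * hr2

/-- The bounded solution of the system of difference equations with given boundary values. -/
theorem eq_interiorSolution (hm : m ≠ 0) (hφ : φ ≠ 0) (hφ1 : ‖φ‖ < 1) (hr1 : ‖r‖ < 1)
    (hr : m * r = l * φ) (hroot : A * φ = m + l * φ ^ 2) (hR₂ : R₂ = r * φ)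
    (hR₁ : l * (R₁ * (1 - R₂) ^ 2) = a * r) {f : ℕ → ℕ → ℂ} {M : ℝ} (hf : ∀ i j, ‖f i j‖ ≤ M)
    (hf0 : ∀ i, f i 0 = b i)
    (hrec0 : ∀ j, A * f 0 (j + 1) = l * f 0 j + m * f 0 (j + 2))
    (hrec : ∀ i j, A * f (i + 1) (j + 1) =
      a * f i (j + 1) + l * f (i + 1) j + m * f (i + 1) (j + 2)) (i j : ℕ) :
    f i j = interiorSolution R₁ R₂ r b i j := by
  induction i generalizing j with
  | zero =>
    obtain ⟨M', hM'⟩ := exists_norm_interiorSolution_le (R₁ := R₁) (R₂ := R₂) (b := b) hr1 0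
    refine sub_eq_zero.1 (eq_zero_of_homogeneous (A := A)
      (d := fun j => f 0 j - interiorSolution R₁ R₂ r b 0 j) (M := M + M') hφ1 hm hr hroot
      (fun j => (norm_sub_le _ _).trans (add_le_add (hf 0 j) (hM' j)))
      (by simp [hf0, interiorSolution]) (fun j => ?_) j)
    linear_combination hrec0 j - interiorSolution_zero_rec hm hφ hr hroot j
  | succ i ih =>
    obtain ⟨M', hM'⟩ := exists_norm_interiorSolution_le (R₁ := R₁) (R₂ := R₂) (b := b) hr1 (i + 1)
    refine sub_eq_zero.1 (eq_zero_of_homogeneous (A := A)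
      (d := fun j => f (i + 1) j - interiorSolution R₁ R₂ r b (i + 1) j) (M := M + M') hφ1 hm hr
      hroot (fun j => (norm_sub_le _ _).trans (add_le_add (hf _ j) (hM' j)))
      (by simp [hf0, interiorSolution]) (fun j => ?_) j)
    linear_combination hrec i j - interiorSolution_succ_rec hm hφ hr hroot hR₂ hR₁ i j +
      a * ih (j + 1)

end Solution

/-! ### Assembling the result -/

theorem theorem2 (c : ℕ) (hc : 1 ≤ c) (lam₁ lam₂ mu₁ mu₂ : ℝ)
    (hlam₁ : 0 < lam₁) (hlam₂ : 0 < lam₂) (hmu₁ : 0 < mu₁) (hmu₂ : 0 < mu₂)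
    -- the two-class priority queue, initially empty
    {Ω : Type*} [MeasurableSpace Ω] (P : Measure Ω) [IsProbabilityMeasure P]
    (X : ℝ≥0 → Ω → ℕ × ℕ)
    (hX : IsCTMC (rateMatrix (priorityQueueRate c lam₁ lam₂ mu₁ mu₂)) P X)
    (hX0 : ∀ᵐ ω ∂P, X 0 ω = (0, 0))
    -- an `M/M/1` queue, started with one customer, which defines the busy period
    {Ω' : Type*} [MeasurableSpace Ω'] (P' : Measure Ω') [IsProbabilityMeasure P']
    (Q : ℝ≥0 → Ω' → ℕ)
    (hQ : IsCTMC (rateMatrix (mm1Rate lam₂ ((c : ℝ) * mu₂))) P' Q)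
    (hQcont : HasRightContPaths P' Q)
    (hQ0 : ∀ᵐ ω ∂P', Q 0 ω = 1)
    (α : ℂ) (hα : 0 < α.re)
    -- abbreviations
    (π : ℕ × ℕ → ℂ) (hπ : ∀ x, π x = stateLaplace P X x α)
    (ρ₂ φ₂ r₂ Ω₂ R₁ R₂ : ℂ)
    (hρ₂ : ρ₂ = (lam₂ : ℂ) / ((c : ℂ) * (mu₂ : ℂ)))
    (hφ₂ : φ₂ = busyPeriodLST P' Q ((lam₁ : ℂ) + α))
    (hr₂ : r₂ = ρ₂ * φ₂)
    (hΩ₂ : Ω₂ = ρ₂ * φ₂ / ((lam₂ : ℂ) * (1 - ρ₂ * φ₂ ^ 2)))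
    (hR₁ : R₁ = (lam₁ : ℂ) * Ω₂ / (1 - r₂ * φ₂))
    (hR₂ : R₂ = r₂ * φ₂)
    (v : ℕ → ℕ → ℂ) (hv : v = interiorCoeff R₁ R₂ (fun i => π (i, c - 1))) :
    -- the transforms and the quotients are well defined
    (∀ x : ℕ × ℕ, IntegrableOn (fun t : ℝ => Complex.exp (-(α * (t : ℂ))) *
        (P.real {ω | X t.toNNReal ω = x} : ℂ)) (Ioi 0)) ∧
    1 - r₂ * φ₂ ≠ 0 ∧
    -- the recursion
    v 0 0 = π (0, c - 1) ∧
    (∀ i : ℕ, v (i + 1) 0 = π (i + 1, c - 1)) ∧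
    (∀ i j : ℕ, 1 ≤ j → j ≤ i + 1 →
      v (i + 1) j = R₁ * (v i (j - 1) + R₂ * ∑ k ∈ Finset.Icc j i, v i k)) ∧
    -- the transforms
    ∀ i j : ℕ, 1 ≤ j →
      π (i, c - 1 + j) =
        ∑ k ∈ Finset.range (i + 1),
          v i k * (1 - R₂) ^ k * (Nat.choose (j - 1 + k) k : ℂ) * r₂ ^ j := by
  obtain ⟨hXm, p, hp, hmarkov⟩ := hX
  have hprob : ∀ (t : ℝ≥0) (x : ℕ × ℕ), P.real {ω | X t ω = x} = p t (0, 0) x :=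
    IsCTMC.real_eq_transition hmarkov hX0
  have hK := rateMatrix_priorityQueue_diag_ge (c := c) hlam₁ hlam₂ hmu₁ hmu₂
  have hπ' : ∀ x, π x = transitionLaplace p α (0, 0) x := fun x => by
    rw [hπ, stateLaplace, transitionLaplace]
    simp only [hprob]
  have hcpos : (0 : ℝ) < c := by exact_mod_cast hc
  have hcmu : 0 < (c : ℝ) * mu₂ := by positivity
  have hs : 0 < ((lam₁ : ℂ) + α).re := by
    simp
    linarith
  obtain ⟨z, hz, hz', hroot⟩ := exists_busyPeriod_root hlam₂ hcmu hs
  have hφz : φ₂ = z := hφ₂.trans (busyPeriodLST_eq hQ hQcont hQ0 hlam₂ hcmu hs hz.le hroot)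
  rw [← hφz] at hz hz' hroot
  have hcC : (c : ℂ) ≠ 0 := by exact_mod_cast hcpos.ne'
  have hmuC : (mu₂ : ℂ) ≠ 0 := by exact_mod_cast hmu₂.ne'
  have hlamC : (lam₂ : ℂ) ≠ 0 := by exact_mod_cast hlam₂.ne'
  have hm : (c : ℂ) * mu₂ ≠ 0 := mul_ne_zero hcC hmuC
  push_cast at hroot
  have hφ0 : φ₂ ≠ 0 := by
    rintro h0
    rw [h0] at hroot
    exact hm (by simpa using hroot.symm)
  have hr : (c : ℂ) * mu₂ * r₂ = lam₂ * φ₂ := by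
    rw [hr₂, hρ₂]
    field_simp
  -- `r₂` is the reciprocal of the other root, which lies outside the unit disc: this is the bound
  -- `lam₂ ‖φ₂‖ < c mu₂`.
  have hr1 : ‖r₂‖ < 1 := by
    have h1 : (c : ℝ) * mu₂ * ‖r₂‖ = lam₂ * ‖φ₂‖ := by
      have := congrArg norm hr
      simpa [abs_of_pos hmu₂, abs_of_pos hlam₂] using this
    rw [← h1] at hz'
    nlinarith
  have hR₂1 : ‖R₂‖ < 1 := by
    rw [hR₂, norm_mul]
    nlinarith [norm_nonneg r₂, norm_nonneg φ₂]
  have hne : 1 - R₂ ≠ 0 := by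
    intro h0
    rw [← sub_eq_zero.1 h0] at hR₂1
    simp at hR₂1
  have hR₁' : (lam₂ : ℂ) * (R₁ * (1 - R₂) ^ 2) = lam₁ * r₂ := by
    have hΩ' : Ω₂ = r₂ / (lam₂ * (1 - R₂)) := by
      rw [hΩ₂, hR₂, hr₂]
      ring_nf
    rw [hR₁, ← hR₂, hΩ']
    field_simp
  refine ⟨fun x => ?_, hR₂ ▸ hne, ?_, fun i => ?_, fun i j hj hji => ?_, fun i j hj => ?_⟩
  · simp only [hprob]
    exact hp.integrableOn_laplace hK hα _ _
  · rw [hv, interiorCoeff_zero]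
  · rw [hv, interiorCoeff_zero]
  · obtain ⟨j, rfl⟩ : ∃ k, j = k + 1 := ⟨j - 1, by omega⟩
    rw [hv, interiorCoeff, Nat.add_sub_cancel]
  · obtain ⟨j, rfl⟩ : ∃ k, j = k + 1 := ⟨j - 1, by omega⟩
    -- Index `0` of the recurrence is level `c - 1`, so its step `j + 1` concerns the level `c + j`,
    -- where all servers are taken by class 2.
    have key := eq_interiorSolution (A := lam₁ + α + lam₂ + c * mu₂) (a := (lam₁ : ℂ))
      (b := fun i => π (i, c - 1)) hm hφ0 hz hr1 hr (by linear_combination hroot) hR₂ hR₁'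
      (f := fun i j => π (i, c - 1 + j))
      (fun i j => by rw [hπ']; exact hp.norm_transitionLaplace_le hα _ _) (fun i => rfl)
      (fun j => ?_) (fun i j => ?_) i (j + 1)
    · rw [key, interiorSolution, hv, Nat.add_sub_cancel]
    · have := priorityQueue_laplace_zero hp hc hlam₁ hlam₂ hmu₁ hmu₂ hα (j := c - 1 + j)
        (by omega)
      simp only [← hπ'] at this
      linear_combination this
    · have := priorityQueue_laplace_succ hp hc hlam₁ hlam₂ hmu₁ hmu₂ hα i (j := c - 1 + j)
        (by omega)
      simp only [← hπ'] at this
      linear_combination this
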